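/- Let $d\ge 1$ and let $\Omega\subset\mathbb R^d$ be a nonempty bounded open set with Lipschitz boundary (for instance a bounded polygonal domain with Lipschitz boundary). All spaces are real. $H^1_0(\Omega)$ is the closure of $C_c^\infty(\Omega)$ in $H^1(\Omega)$, $H^{-1}(\Omega)$ is its dual, and $f\in L_2(\Omega)$ is identified with the functional $\phi\mapsto\int_\Omega f\phi$ in $H^{-1}(\Omega)$. Let $A$ be a bounded bilinear form on $H^1(\Omega)\times H^1_0(\Omega)$ whose restriction to $H^1_0(\Omega)\times H^1_0(\Omega)$ is symmetric and $H^1$-coercive, and put $\|u\|_0=\|u\|_{L_2(\Omega)}$ and $\|u\|_1=A(u,u)^{1/2}$ for $u\in H^1_0(\Omega)$. Let $L:H^1(\Omega)\to H^{-1}(\Omega)$ be defined by $\langle Lu,\phi\rangle=A(u,\phi)$ for all $\phi\in H^1_0(\Omega)$, and let $T:H^{-1}(\Omega)\to H^1_0(\Omega)$ be defined by $A(TF,\phi)=\langle F,\phi\rangle$ for all $\phi\in H^1_0(\Omega)$. Let $[\cdot,\cdot]_\theta$ denote real interpolation (K-method, second index $2$, with $[X_0,X_1]_0=X_0$ and $[X_0,X_1]_1=X_1$).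 For $1\le s\le 2$ let $H^s(\Omega)=[H^1(\Omega),H^2(\Omega)]_{s-1}$. For $-1\le s\le 2$ define $$\widetilde H^s(\Omega)=\begin{cases}H^1_0(\Omega)\cap H^s(\Omega)\ \text{(with the norm of }H^s(\Omega)),&1\le s\le 2,\\ [L_2(\Omega),H^1_0(\Omega)]_s,&0\le s\le1,\\ [H^{-1}(\Omega),L_2(\Omega)]_{1+s},&-1\le s\le0.\end{cases}$$ Assume (a) $H^1_0(\Omega)$ is compactly and densely contained in $L_2(\Omega)$; (b) there is a constant $c_0$ with $\|u\|_0\le c_0\|u\|_1$ for all $u\in H^1_0(\Omega)$. Then $T$, as an operator on $H^{-1}(\Omega)$, has eigenvalues $\mu_1\ge\mu_2\ge\dots>0$ with $\mu_i\to0$ and eigenfunctions $\psi_i$ ($T\psi_i=\mu_i\psi_i$) that form an orthonormal basis of $H^{-1}(\Omega)$ for the inner product $\langle F,G\rangle_{-1}=\langle F,TG\rangle$. For any such $(\mu_i)$ and $(\psi_i)$ put $\widetilde\psi_i=\mu_i^{1/2}\psi_i\in H^1_0(\Omega)$ and, for $s\ge-1$, $$\dot H^s=\Big\{F\in H^{-1}(\Omega):\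 \|F\|_{\dot H^s}^2:=\sum_{i=1}^\infty\mu_i^{-s}\langle F,\widetilde\psi_i\rangle^2<\infty\Big\}.$$ Then: 1. For every $s\in[-1,1]$ the spaces $\widetilde H^s(\Omega)$ and $\dot H^s$ coincide and their norms are equivalent. 2. If, in addition, for some $0<\alpha\le1$, (c) $T$ is a bounded map of $\widetilde H^{-1+\alpha}(\Omega)$ into $\widetilde H^{1+\alpha}(\Omega)$, and (d) the restriction of $L$ is a bounded operator from $H^{1+\alpha}(\Omega)$ to $\widetilde H^{-1+\alpha}(\Omega)$, then for every $s\in[1,1+\alpha]$ the spaces $\widetilde H^s(\Omega)$ and $\dot H^s$ coincide and their norms are equivalent. -/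

import Mathlib

open MeasureTheory Set Filter Topology
open scoped ENNReal NNReal ContDiff

noncomputable section

namespace FracElliptic

/-! ### Domains, test functions, weak derivatives and Sobolev spaces of integer order -/

/-- The Euclidean space `ℝ^d`. -/
abbrev E (d : ℕ) : Type := EuclideanSpace ℝ (Fin d)

/-- `Ω` has a Lipschitz boundary: near each boundary point, `Ω` is the strict epigraph, in some
unit direction `e`, of a Lipschitz function `γ` of the variables orthogonal to `e`. -/
def HasLipschitzBoundary {d : ℕ} (Ω : Set (E d)) : Prop :=
  ∀ x₀ ∈ frontier Ω, ∃ r : ℝ, 0 < r ∧ ∃ e : E d, ‖e‖ = 1 ∧ ∃ (K : ℝ≥0) (γ : E d → ℝ),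
    LipschitzWith K γ ∧ (∀ (y : E d) (t : ℝ), γ (y + t • e) = γ y) ∧
      ∀ y ∈ Metric.ball x₀ r, (y ∈ Ω ↔ γ y < inner ℝ e y)

/-- Real square integrable functions on `Ω`. -/
abbrev L2 {d : ℕ} (Ω : Set (E d)) : Type := Lp ℝ 2 (volume.restrict Ω)

/-- Smooth functions with compact support in `Ω`. -/
structure IsTest {d : ℕ} (Ω : Set (E d)) (φ : E d → ℝ) : Prop where
  smooth : ContDiff ℝ ∞ φ
  compact : HasCompactSupport φ
  supp : tsupport φ ⊆ Ω

/-- The iterated partial derivative `∂_{w 0} ⋯ ∂_{w (k-1)} φ (x)`. -/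
def partialDeriv {d k : ℕ} (w : Fin k → Fin d) (φ : E d → ℝ) (x : E d) : ℝ :=
  iteratedFDeriv ℝ k φ x (fun j => EuclideanSpace.single (w j) (1 : ℝ))

/-- `g` is the weak derivative `∂_{w 0} ⋯ ∂_{w (k-1)} u` on `Ω`. -/
def IsWeakDeriv {d k : ℕ} (Ω : Set (E d)) (w : Fin k → Fin d) (u g : L2 Ω) : Prop :=
  ∀ φ, IsTest Ω φ →
    ∫ x in Ω, u x * partialDeriv w φ x = (-1 : ℝ) ^ k * ∫ x in Ω, g x * φ x

/-- Indices of all iterated partial derivatives of order at most `k`. -/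
abbrev DerivIndex (d k : ℕ) : Type := Σ j : Fin (k + 1), (Fin j → Fin d)

/-- The index of the derivative of order `0`. -/
def DerivIndex.zero (d k : ℕ) : DerivIndex d k := ⟨0, fun j => j.elim0⟩

lemma continuous_partialDeriv {d k : ℕ} {Ω : Set (E d)} {φ : E d → ℝ} (hφ : IsTest Ω φ)
    (w : Fin k → Fin d) : Continuous (partialDeriv w φ) := by
  have h : Continuous (iteratedFDeriv ℝ k φ) :=
    hφ.smooth.continuous_iteratedFDeriv (by exact_mod_cast le_top)
  exact (continuous_eval_const
    (fun j => EuclideanSpace.single (w j) (1 : ℝ)) : Continuous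
      fun q : ContinuousMultilinearMap ℝ (fun _ : Fin k => E d) ℝ => q _).comp h

lemma hasCompactSupport_partialDeriv {d k : ℕ} {Ω : Set (E d)} {φ : E d → ℝ} (hφ : IsTest Ω φ)
    (w : Fin k → Fin d) : HasCompactSupport (partialDeriv w φ) :=
  (hφ.compact.iteratedFDeriv k).comp_left
    (g := fun q : ContinuousMultilinearMap ℝ (fun _ : Fin k => E d) ℝ =>
      q (fun j => EuclideanSpace.single (w j) (1 : ℝ))) rfl

/-- Integration against a continuous function with compact support is a bounded functional. -/
lemma exists_integral_eq_inner {d : ℕ} (Ω : Set (E d)) {h : E d → ℝ} (hc : Continuous h)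
    (hs : HasCompactSupport h) :
    ∃ H : L2 Ω, ∀ u : L2 Ω, ∫ x in Ω, u x * h x = inner ℝ H u := by
  have hm : MemLp h 2 (volume.restrict Ω) := hc.memLp_of_hasCompactSupport hs
  refine ⟨hm.toLp h, fun u => ?_⟩
  rw [L2.inner_def]
  refine integral_congr_ae ?_
  filter_upwards [hm.coeFn_toLp] with x hx
  simp [hx]

/-- The Sobolev space `H^k(Ω)` of all `u ∈ L²(Ω)` whose weak derivatives of order at most `k` are
in `L²(Ω)`. An element is the family of its weak derivatives, so that the norm inherited from the
Hilbert sum is `(∑_{j ≤ k} ‖∇^j u‖²_{L²})^{1/2}`. -/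
def Sobolev {d : ℕ} (Ω : Set (E d)) (k : ℕ) :
    Submodule ℝ (PiLp 2 (fun _ : DerivIndex d k => L2 Ω)) where
  carrier := {v | ∀ i : DerivIndex d k, IsWeakDeriv Ω i.2 (v (DerivIndex.zero d k)) (v i)}
  zero_mem' := by
    intro i φ hφ
    obtain ⟨H, hH⟩ := exists_integral_eq_inner Ω (continuous_partialDeriv hφ i.2)
      (hasCompactSupport_partialDeriv hφ i.2)
    obtain ⟨G, hG⟩ := exists_integral_eq_inner Ω hφ.smooth.continuous hφ.compact
    rw [hH, hG]; simp
  add_mem' := by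
    intro a b ha hb i φ hφ
    have h1 := ha i φ hφ
    have h2 := hb i φ hφ
    obtain ⟨H, hH⟩ := exists_integral_eq_inner Ω (continuous_partialDeriv hφ i.2)
      (hasCompactSupport_partialDeriv hφ i.2)
    obtain ⟨G, hG⟩ := exists_integral_eq_inner Ω hφ.smooth.continuous hφ.compact
    rw [hH, hG] at h1 h2 ⊢
    simp only [PiLp.add_apply, inner_add_right, h1, h2]
    ring
  smul_mem' := by
    intro c a ha i φ hφ
    have h1 := ha i φ hφ
    obtain ⟨H, hH⟩ := exists_integral_eq_inner Ω (continuous_partialDeriv hφ i.2)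
      (hasCompactSupport_partialDeriv hφ i.2)
    obtain ⟨G, hG⟩ := exists_integral_eq_inner Ω hφ.smooth.continuous hφ.compact
    rw [hH, hG] at h1 ⊢
    simp only [PiLp.smul_apply, inner_smul_right, h1]
    ring

lemma isClosed_sobolev {d : ℕ} (Ω : Set (E d)) (k : ℕ) :
    IsClosed (Sobolev Ω k : Set (PiLp 2 (fun _ : DerivIndex d k => L2 Ω))) := by
  have : (Sobolev Ω k : Set (PiLp 2 (fun _ : DerivIndex d k => L2 Ω))) =
      ⋂ (i : DerivIndex d k) (φ : E d → ℝ) (_ : IsTest Ω φ),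
        {v | ∫ x in Ω, v (DerivIndex.zero d k) x * partialDeriv i.2 φ x =
          (-1 : ℝ) ^ (i.1 : ℕ) * ∫ x in Ω, v i x * φ x} := by
    ext v
    simp only [mem_iInter]
    rfl
  rw [this]
  refine isClosed_iInter fun i => isClosed_iInter fun φ => isClosed_iInter fun hφ => ?_
  obtain ⟨H, hH⟩ := exists_integral_eq_inner Ω (continuous_partialDeriv hφ i.2)
    (hasCompactSupport_partialDeriv hφ i.2)
  obtain ⟨G, hG⟩ := exists_integral_eq_inner Ω hφ.smooth.continuous hφ.compact
  simp only [hH, hG]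
  exact isClosed_eq (by fun_prop) (by fun_prop)

instance {d : ℕ} (Ω : Set (E d)) (k : ℕ) : NormedAddCommGroup (Sobolev Ω k) :=
  Submodule.normedAddCommGroup _

instance {d : ℕ} (Ω : Set (E d)) (k : ℕ) : InnerProductSpace ℝ (Sobolev Ω k) :=
  Submodule.innerProductSpace _

instance {d : ℕ} (Ω : Set (E d)) (k : ℕ) : NormedSpace ℝ (Sobolev Ω k) :=
  InnerProductSpace.toNormedSpace

instance {d : ℕ} (Ω : Set (E d)) (k : ℕ) : CompleteSpace (Sobolev Ω k) :=
  (isClosed_sobolev Ω k).completeSpace_coe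

/-- The inclusion `H^k(Ω) → L²(Ω)`. -/
def Sobolev.toL2 {d : ℕ} (Ω : Set (E d)) (k : ℕ) : Sobolev Ω k →L[ℝ] L2 Ω :=
  (PiLp.proj 2 (fun _ : DerivIndex d k => L2 Ω) (DerivIndex.zero d k)).comp
    (Sobolev Ω k).subtypeL

/-- The space `H^1_0(Ω)`, the closure of the test functions in `H^1(Ω)`. -/
def H10 {d : ℕ} (Ω : Set (E d)) : Submodule ℝ (Sobolev Ω 1) :=
  (Submodule.span ℝ
    {v : Sobolev Ω 1 | ∃ φ, IsTest Ω φ ∧ Sobolev.toL2 Ω 1 v =ᵐ[volume.restrict Ω] φ}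
    ).topologicalClosure

instance {d : ℕ} (Ω : Set (E d)) : NormedAddCommGroup (H10 Ω) :=
  Submodule.normedAddCommGroup _

instance {d : ℕ} (Ω : Set (E d)) : InnerProductSpace ℝ (H10 Ω) :=
  Submodule.innerProductSpace _

instance {d : ℕ} (Ω : Set (E d)) : NormedSpace ℝ (H10 Ω) :=
  InnerProductSpace.toNormedSpace

instance {d : ℕ} (Ω : Set (E d)) : CompleteSpace (H10 Ω) :=
  (Submodule.isClosed_topologicalClosure _).completeSpace_coe

/-- The inclusion `H^1_0(Ω) → L²(Ω)`. -/
def H10.toL2 {d : ℕ} (Ω : Set (E d)) : H10 Ω →L[ℝ] L2 Ω :=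
  (Sobolev.toL2 Ω 1).comp (H10 Ω).subtypeL

/-- The space `H^{-1}(Ω)`, the dual of `H^1_0(Ω)`. -/
abbrev Hm1 {d : ℕ} (Ω : Set (E d)) : Type := H10 Ω →L[ℝ] ℝ

/-- The identification of `f ∈ L²(Ω)` with the functional `φ ↦ ∫_Ω f φ` in `H^{-1}(Ω)`. -/
def L2.toHm1 {d : ℕ} (Ω : Set (E d)) : L2 Ω →ₗ[ℝ] Hm1 Ω where
  toFun f := (innerSL ℝ f).comp (H10.toL2 Ω)
  map_add' f g := by ext φ; simp
  map_smul' c f := by ext φ; simp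

/-- The resulting inclusion of `H^1_0(Ω)` in `H^{-1}(Ω)`. -/
def H10.toHm1 {d : ℕ} (Ω : Set (E d)) : H10 Ω →ₗ[ℝ] Hm1 Ω :=
  (L2.toHm1 Ω).comp (H10.toL2 Ω).toLinearMap

/-! ### Real interpolation -/

section Interpolation

variable {X₀ X₁ V : Type*} [NormedAddCommGroup X₀] [NormedSpace ℝ X₀] [NormedAddCommGroup X₁]
  [NormedSpace ℝ X₁] [AddCommGroup V] [Module ℝ V]

/-- The norm of the normed space `X₀`, seen as a subspace of `V` by the injection `j`, as an
extended norm on `V`: it is `∞` off the range of `j`. -/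
def imageNorm (j : X₀ →ₗ[ℝ] V) (v : V) : ℝ≥0∞ := ⨅ (a : X₀) (_ : j a = v), ‖a‖ₑ

/-- The functional `K(t, v) = inf {‖a‖_{X₀} + t ‖b‖_{X₁} : v = a + b}` of a couple of normed spaces
`X₀, X₁`, seen as subspaces of `V` by the injections `j₀, j₁` (`∞` off `X₀ + X₁`). -/
def KFunctional (j₀ : X₀ →ₗ[ℝ] V) (j₁ : X₁ →ₗ[ℝ] V) (t : ℝ) (v : V) : ℝ≥0∞ :=
  ⨅ (a : X₀) (b : X₁) (_ : j₀ a + j₁ b = v), ‖a‖ₑ + ENNReal.ofReal t * ‖b‖ₑ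

open Classical in
/-- The norm of the real interpolation space `[X₀, X₁]_θ` (with second index `2`), as an extended
norm on `V`: `(∫_0^∞ (t^{-θ} K(t, v))² dt/t)^{1/2}` for `0 < θ < 1`, with the usual convention
`[X₀, X₁]_0 = X₀` and `[X₀, X₁]_1 = X₁`. -/
def interpNorm (j₀ : X₀ →ₗ[ℝ] V) (j₁ : X₁ →ₗ[ℝ] V) (θ : ℝ) (v : V) : ℝ≥0∞ :=
  if θ = 0 then imageNorm j₀ v
  else if θ = 1 then imageNorm j₁ v
  else (∫⁻ t in Ioi (0 : ℝ),
    (ENNReal.ofReal (t ^ (-θ)) * KFunctional j₀ j₁ t v) ^ 2 * ENNReal.ofReal t⁻¹) ^ (1 / 2 : ℝ)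

end Interpolation

/-! ### The spaces `H^s(Ω)` and `H̃^s(Ω)` -/

/-- The norm of `H^s(Ω) = [H^1(Ω), H^2(Ω)]_{s-1}`, `1 ≤ s ≤ 2`, as an extended norm on `L²(Ω)`. -/
def HsNorm {d : ℕ} (Ω : Set (E d)) (s : ℝ) (u : L2 Ω) : ℝ≥0∞ :=
  interpNorm (Sobolev.toL2 Ω 1).toLinearMap (Sobolev.toL2 Ω 2).toLinearMap (s - 1) u

open Classical in
/-- The norm of `H̃^s(Ω)`, `-1 ≤ s ≤ 2`, as an extended norm on `H^{-1}(Ω)`. The space is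
`H^1_0(Ω) ∩ H^s(Ω)` for `1 ≤ s ≤ 2`, `[L²(Ω), H^1_0(Ω)]_s` for `0 ≤ s ≤ 1`
and `[H^{-1}(Ω), L²(Ω)]_{1+s}` for `-1 ≤ s ≤ 0`. -/
def tildeNorm {d : ℕ} (Ω : Set (E d)) (s : ℝ) (F : Hm1 Ω) : ℝ≥0∞ :=
  if 1 ≤ s then ⨅ (u : H10 Ω) (_ : H10.toHm1 Ω u = F), HsNorm Ω s (H10.toL2 Ω u)
  else if 0 ≤ s then interpNorm (L2.toHm1 Ω) (H10.toHm1 Ω) s F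
  else interpNorm (LinearMap.id : Hm1 Ω →ₗ[ℝ] Hm1 Ω) (L2.toHm1 Ω) (1 + s) F

/-- The space `H̃^s(Ω)`, as a subset of `H^{-1}(Ω)`. -/
def tildeSpace {d : ℕ} (Ω : Set (E d)) (s : ℝ) : Set (Hm1 Ω) := {F | tildeNorm Ω s F < ⊤}

/-! ### The form `A`, the operators `T` and `L`, and the spaces `Ḣ^s` -/

section Form

variable {d : ℕ} {Ω : Set (E d)}

/-- The restriction to `H^1_0(Ω) × H^1_0(Ω)` of a form on `H^1(Ω) × H^1_0(Ω)`. -/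
def restrictForm (A : Sobolev Ω 1 →L[ℝ] H10 Ω →L[ℝ] ℝ) : H10 Ω →L[ℝ] H10 Ω →L[ℝ] ℝ :=
  A.comp (H10 Ω).subtypeL

/-- The solution operator `T : H^{-1}(Ω) → H^1_0(Ω)`; `T F` is the unique `u ∈ H^1_0(Ω)` with
`A(u, φ) = ⟨F, φ⟩` for all `φ ∈ H^1_0(Ω)`. -/
def solutionOp (A : Sobolev Ω 1 →L[ℝ] H10 Ω →L[ℝ] ℝ) (hA : IsCoercive (restrictForm A)) :
    Hm1 Ω →ₗ[ℝ] H10 Ω where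
  toFun F := hA.continuousLinearEquivOfBilin.symm ((InnerProductSpace.toDual ℝ (H10 Ω)).symm F)
  map_add' F G := by simp
  map_smul' c F := by simp

lemma solutionOp_eq_iff (A : Sobolev Ω 1 →L[ℝ] H10 Ω →L[ℝ] ℝ)
    (hA : IsCoercive (restrictForm A)) (F : Hm1 Ω) (u : H10 Ω) :
    solutionOp A hA F = u ↔ ∀ φ : H10 Ω, A u φ = F φ := by
  have key : ∀ v φ : H10 Ω, A v φ = inner ℝ (hA.continuousLinearEquivOfBilin v) φ := by
    intro v φ
    rw [hA.continuousLinearEquivOfBilin_apply]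
    rfl
  have hT : hA.continuousLinearEquivOfBilin (solutionOp A hA F) =
      (InnerProductSpace.toDual ℝ (H10 Ω)).symm F := by
    simp [solutionOp]
  constructor
  · rintro rfl φ
    rw [key, hT, InnerProductSpace.toDual_symm_apply]
  · intro h
    apply hA.continuousLinearEquivOfBilin.injective
    rw [hT]
    refine ext_inner_right ℝ fun φ => ?_
    rw [InnerProductSpace.toDual_symm_apply, ← key, h]

/-- `(μ_i)` and `(ψ_i)` are the eigenvalues (positive, non-increasing, with limit `0`) and
eigenfunctions of `T : H^{-1}(Ω) → H^{-1}(Ω)`, where `(ψ_i)` is an orthonormal basis of `H^{-1}(Ω)`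
for the inner product `⟨F, G⟩_{-1} = ⟨F, T G⟩`. As the eigenvalues are not zero, the
eigenfunctions are in the range `H^1_0(Ω)` of `T`, and they are given as elements of it. -/
structure IsEigenbasis (A : Sobolev Ω 1 →L[ℝ] H10 Ω →L[ℝ] ℝ) (hA : IsCoercive (restrictForm A))
    (μ : ℕ → ℝ) (ψ : ℕ → H10 Ω) : Prop where
  pos : ∀ i, 0 < μ i
  antitone : Antitone μ
  tendsto : Tendsto μ atTop (𝓝 0)
  eigen : ∀ i, solutionOp A hA (H10.toHm1 Ω (ψ i)) = μ i • ψ i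
  orthonormal : ∀ i j,
    H10.toHm1 Ω (ψ i) (solutionOp A hA (H10.toHm1 Ω (ψ j))) = if i = j then 1 else 0
  complete : (Submodule.span ℝ (range fun i => H10.toHm1 Ω (ψ i))).topologicalClosure = ⊤

/-- The norm of `Ḣ^s`, as an extended norm on `H^{-1}(Ω)`: the square root of
`∑_i μ_i^{-s} ⟨F, ψ̃_i⟩²`, where `ψ̃_i = μ_i^{1/2} ψ_i`. -/
def dotNorm (μ : ℕ → ℝ) (ψ : ℕ → H10 Ω) (s : ℝ) (F : Hm1 Ω) : ℝ≥0∞ :=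
  (∑' i, ENNReal.ofReal ((μ i) ^ (-s) * (F ((μ i) ^ (1 / 2 : ℝ) • ψ i)) ^ 2)) ^ (1 / 2 : ℝ)

/-- The space `Ḣ^s`, as a subset of `H^{-1}(Ω)`. -/
def dotSpace (μ : ℕ → ℝ) (ψ : ℕ → H10 Ω) (s : ℝ) : Set (Hm1 Ω) := {F | dotNorm μ ψ s F < ⊤}

/-- `H̃^s(Ω)` and `Ḣ^s` coincide and their norms are equivalent. -/
def CoincideWithEquivalentNorms (μ : ℕ → ℝ) (ψ : ℕ → H10 Ω) (s : ℝ) : Prop :=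
  tildeSpace Ω s = dotSpace μ ψ s ∧
    ∃ c C : ℝ≥0, 0 < c ∧ ∀ F ∈ tildeSpace Ω s,
      c * dotNorm μ ψ s F ≤ tildeNorm Ω s F ∧ tildeNorm Ω s F ≤ C * dotNorm μ ψ s F

/-- `H^1_0(Ω)` is compactly and densely contained in `L²(Ω)`. -/
def ConditionA (Ω : Set (E d)) : Prop :=
  IsCompactOperator (H10.toL2 Ω) ∧ DenseRange (H10.toL2 Ω)

/-- The inequality `‖u‖_0 ≤ c₀ ‖u‖_1`, with the norms `‖u‖_0 = ‖u‖_{L²}` and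
`‖u‖_1 = A(u, u)^{1/2}`. -/
def ConditionB (A : Sobolev Ω 1 →L[ℝ] H10 Ω →L[ℝ] ℝ) : Prop :=
  ∃ c₀ : ℝ, ∀ u : H10 Ω, ‖H10.toL2 Ω u‖ ≤ c₀ * Real.sqrt (A u u)

/-- `T` is a bounded map of `H̃^{-1+α}(Ω)` into `H̃^{1+α}(Ω)`. -/
def ConditionC (A : Sobolev Ω 1 →L[ℝ] H10 Ω →L[ℝ] ℝ) (hA : IsCoercive (restrictForm A))
    (α : ℝ) : Prop :=
  ∃ C : ℝ≥0, ∀ F ∈ tildeSpace Ω (-1 + α),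
    tildeNorm Ω (1 + α) (H10.toHm1 Ω (solutionOp A hA F)) ≤ C * tildeNorm Ω (-1 + α) F

/-- The operator `L : H^1(Ω) → H^{-1}(Ω)`, `⟨L u, φ⟩ = A(u, φ)` for `φ ∈ H^1_0(Ω)`, restricts to
a bounded operator from `H^{1+α}(Ω)` to `H̃^{-1+α}(Ω)`. -/
def ConditionD (A : Sobolev Ω 1 →L[ℝ] H10 Ω →L[ℝ] ℝ) (α : ℝ) : Prop :=
  ∃ C : ℝ≥0, ∀ u : Sobolev Ω 1, HsNorm Ω (1 + α) (Sobolev.toL2 Ω 1 u) < ⊤ →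
    tildeNorm Ω (-1 + α) (A u) ≤ C * HsNorm Ω (1 + α) (Sobolev.toL2 Ω 1 u)

end Form

end FracElliptic

end

/-!
The spaces `Ḣ^s` are weighted `ℓ²` spaces in the coefficients `⟨F, ψ̃_i⟩`, and everything is reduced
to computations with these weights.

* Existence of the eigenfunctions: with the energy inner product `A(u, v)`, `H^1_0(Ω)` is a Hilbert
  space `W` and `T` becomes `K* K` for the compact injection `K : W → L²(Ω)`, so that the spectral
  theorem for compact self-adjoint operators applies (`exists_isEigenbasis`).
* For `s = -1, 0, 1` the coefficients are, up to powers of `μ_i`, the Fourier coefficients for a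
  Hilbert basis of `H^{-1}(Ω)`, `L²(Ω)` and `W`, which identifies these spaces with `Ḣ^s`
  (`imageNorm_eq_dotNorm`).
* The square of the K-functional of the couple `Ḣ^p, Ḣ^{p+α}` at `t^α` is comparable to the diagonal
  sum `spectralK`, by splitting along the eigenfunctions; its integral against `t^{-2σ} dt/t` is a
  multiple of the squared norm of `Ḣ^{p+σ}` (`lintegral_spectralK`). Hence interpolation between
  the three spaces above gives `Ḣ^s` for `-1 ≤ s ≤ 1` (`IsEigenbasis.normEquiv_tildeNorm`).
* For `s = 1 + α`, `T` and `L` are mutually inverse between `Ḣ^{-1+α}` and `Ḣ^{1+α}`, and by (c), (d)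
  and the previous case they are bounded between `Ḣ^{-1+α}` and `H̃^{1+α}(Ω)`
  (`IsEigenbasis.normEquiv_tildeNorm_one_add`).
* For `s = 1 + σ` with `0 < σ < α`, the inclusion of `Ḣ^s` in `H^s(Ω)` follows by splitting along the
  eigenfunctions (`IsEigenbasis.KFunctional_le_spectralK`). For the converse it is not possible to
  interpolate the inclusions, as the parts `a, b` of a splitting of `u` need not vanish on the
  boundary. But `L` is defined on all of `H^1(Ω)`, and `L a`, `L b` are controlled in `Ḣ^{-1}` and,
  by (d), in `Ḣ^{-1+α}` (`IsEigenbasis.spectralK_le_kTail`). Both directions use the reiteration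
  `[H^1, [H^1, H^2]_α]_{σ/α} = [H^1, H^2]_σ` in the form of `exists_KFunctional_le_interpNorm` and
  of Holmstedt's estimate `exists_split_le_kTail`, which is integrated by `lintegral_kTail`.
-/

namespace FracElliptic

/-! ### Integrals of powers -/

lemma lintegral_Ioc_rpow {p c : ℝ} (hp : 0 < p) (hc : 0 ≤ c) :
    ∫⁻ s in Ioc 0 c, ENNReal.ofReal (s ^ (p - 1)) = ENNReal.ofReal (c ^ p / p) := by
  have h : (-1 : ℝ) < p - 1 := by linarith
  have hi : IntegrableOn (fun s : ℝ => s ^ (p - 1)) (Ioc 0 c) :=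
    (intervalIntegrable_iff_integrableOn_Ioc_of_le hc).1
      (intervalIntegral.intervalIntegrable_rpow' h)
  rw [← ofReal_integral_eq_lintegral_ofReal hi, ← intervalIntegral.integral_of_le hc,
    integral_rpow (Or.inl h)]
  · simp [Real.zero_rpow hp.ne']
  · exact (ae_restrict_iff' measurableSet_Ioc).2
      (ae_of_all _ fun s hs => Real.rpow_nonneg hs.1.le _)

lemma lintegral_Ioi_rpow {p c : ℝ} (hp : 0 < p) (hc : 0 < c) :
    ∫⁻ s in Ioi c, ENNReal.ofReal (s ^ (-p - 1)) = ENNReal.ofReal (c ^ (-p) / p) := by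
  have h : -p - 1 < -1 := by linarith
  rw [← ofReal_integral_eq_lintegral_ofReal (integrableOn_Ioi_rpow_of_lt h hc),
    integral_Ioi_rpow_of_lt h hc]
  · congr 1
    rw [show -p - 1 + 1 = -p by ring, neg_div_neg_eq]
  · exact (ae_restrict_iff' measurableSet_Ioi).2
      (ae_of_all _ fun s hs => Real.rpow_nonneg (hc.trans hs).le _)

lemma measurable_ofReal_rpow (p : ℝ) : Measurable fun s : ℝ => ENNReal.ofReal (s ^ p) := by
  fun_prop

lemma ofReal_rpow_mul {t : ℝ} (ht : 0 < t) (p q : ℝ) :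
    ENNReal.ofReal (t ^ p) * ENNReal.ofReal (t ^ q) = ENNReal.ofReal (t ^ (p + q)) := by
  rw [← ENNReal.ofReal_mul (Real.rpow_nonneg ht.le _), Real.rpow_add ht]

/-! ### The K-functional and reiteration -/

section KFunctional

variable {X₀ X₁ V : Type*} [NormedAddCommGroup X₀] [NormedSpace ℝ X₀] [NormedAddCommGroup X₁]
  [NormedSpace ℝ X₁] [AddCommGroup V] [Module ℝ V] (j₀ : X₀ →ₗ[ℝ] V) (j₁ : X₁ →ₗ[ℝ] V)

lemma imageNorm_apply_le (a : X₀) : imageNorm j₀ (j₀ a) ≤ ‖a‖ₑ :=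
  iInf₂_le_of_le a rfl le_rfl

variable {j₀} in
lemma imageNorm_of_injective (h : Function.Injective j₀) (a : X₀) : imageNorm j₀ (j₀ a) = ‖a‖ₑ :=
  le_antisymm (imageNorm_apply_le _ _) (le_iInf₂ fun b hb => by rw [h hb])

variable {j₀} in
lemma exists_of_imageNorm_lt_top {v : V} (h : imageNorm j₀ v < ⊤) : ∃ a, j₀ a = v := by
  simp only [imageNorm, iInf_lt_iff] at h
  obtain ⟨a, ha, -⟩ := h
  exact ⟨a, ha⟩

lemma KFunctional_le (t : ℝ) (a : X₀) (b : X₁) :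
    KFunctional j₀ j₁ t (j₀ a + j₁ b) ≤ ‖a‖ₑ + ENNReal.ofReal t * ‖b‖ₑ :=
  iInf₂_le_of_le a b (iInf_le _ rfl)

lemma KFunctional_left_le (t : ℝ) (a : X₀) : KFunctional j₀ j₁ t (j₀ a) ≤ ‖a‖ₑ := by
  simpa using KFunctional_le j₀ j₁ t a 0

lemma KFunctional_right_le (t : ℝ) (b : X₁) :
    KFunctional j₀ j₁ t (j₁ b) ≤ ENNReal.ofReal t * ‖b‖ₑ := by
  simpa using KFunctional_le j₀ j₁ t 0 b

lemma KFunctional_le_imageNorm (t : ℝ) (v : V) :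
    KFunctional j₀ j₁ t v ≤ imageNorm j₀ v :=
  le_iInf₂ fun a ha => ha ▸ KFunctional_left_le j₀ j₁ t a

/-- For `t = 0` this can fail, as then the right side is `0` also for `v` outside of `X₁`. -/
lemma KFunctional_le_mul_imageNorm {t : ℝ} (ht : 0 < t) (v : V) :
    KFunctional j₀ j₁ t v ≤ ENNReal.ofReal t * imageNorm j₁ v := by
  have h0 : ENNReal.ofReal t ≠ 0 := by simpa using ht
  unfold imageNorm
  simp only [ENNReal.mul_iInf_of_ne h0 ENNReal.ofReal_ne_top]
  exact le_iInf₂ fun b hb => hb ▸ KFunctional_right_le j₀ j₁ t b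

lemma KFunctional_mono (v : V) : Monotone fun t => KFunctional j₀ j₁ t v := by
  intro s t hst
  unfold KFunctional
  dsimp only
  gcongr

lemma measurable_KFunctional (v : V) : Measurable fun t => KFunctional j₀ j₁ t v :=
  (KFunctional_mono j₀ j₁ v).measurable

lemma KFunctional_add_le (t : ℝ) (x y : V) :
    KFunctional j₀ j₁ t (x + y) ≤ KFunctional j₀ j₁ t x + KFunctional j₀ j₁ t y := by
  conv_rhs => unfold KFunctional
  simp only [ENNReal.iInf_add, ENNReal.add_iInf]
  refine le_iInf₂ fun a b => le_iInf₂ fun h a' => le_iInf₂ fun b' h' => ?_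
  have := KFunctional_le j₀ j₁ t (a + a') (b + b')
  rw [map_add, map_add, show j₀ a + j₀ a' + (j₁ b + j₁ b') = x + y by rw [← h, ← h']; abel] at this
  refine this.trans ?_
  calc ‖a + a'‖ₑ + ENNReal.ofReal t * ‖b + b'‖ₑ
      ≤ (‖a‖ₑ + ‖a'‖ₑ) + ENNReal.ofReal t * (‖b‖ₑ + ‖b'‖ₑ) := by
        gcongr <;> exact enorm_add_le _ _
    _ = _ := by ring

lemma interpNorm_sq {θ : ℝ} (h0 : 0 < θ) (h1 : θ < 1) (v : V) :
    interpNorm j₀ j₁ θ v ^ 2 = ∫⁻ t in Ioi (0 : ℝ),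
      ENNReal.ofReal (t ^ (-(2 * θ) - 1)) * KFunctional j₀ j₁ t v ^ 2 := by
  unfold interpNorm
  rw [if_neg h0.ne', if_neg h1.ne, ← ENNReal.rpow_natCast, ← ENNReal.rpow_mul]
  norm_num
  refine setLIntegral_congr_fun measurableSet_Ioi fun t ht => ?_
  have ht : (0 : ℝ) < t := ht
  have : ENNReal.ofReal (t ^ (-(2 * θ) - 1)) =
      ENNReal.ofReal (t ^ (-θ)) ^ 2 * ENNReal.ofReal t⁻¹ := by
    rw [← Real.rpow_neg_one t, sq, ofReal_rpow_mul ht, ofReal_rpow_mul ht]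
    congr 2
    ring
  rw [this]
  ring

/-- The part of the interpolation integral of exponent `α` that lies beyond `t`. -/
noncomputable def kTail (α t : ℝ) (v : V) : ℝ≥0∞ :=
  ∫⁻ s in Ioi t, ENNReal.ofReal (s ^ (-(2 * α) - 1)) * KFunctional j₀ j₁ s v ^ 2

/-- Since `K` is non-decreasing, its value at `t` is controlled by its tail. -/
lemma KFunctional_sq_le_kTail {α t : ℝ} (hα : 0 < α) (ht : 0 < t) (v : V) :
    KFunctional j₀ j₁ t v ^ 2 ≤
      ENNReal.ofReal (2 * α) * (ENNReal.ofReal (t ^ (2 * α)) * kTail j₀ j₁ α t v) := by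
  have h : ENNReal.ofReal (t ^ (-(2 * α)) / (2 * α)) * KFunctional j₀ j₁ t v ^ 2 ≤
      kTail j₀ j₁ α t v := by
    rw [← lintegral_Ioi_rpow (by positivity) ht, ← lintegral_mul_const _
      (measurable_ofReal_rpow _)]
    refine setLIntegral_mono' measurableSet_Ioi fun s hs => ?_
    gcongr
    exact KFunctional_mono j₀ j₁ v (le_of_lt hs)
  calc KFunctional j₀ j₁ t v ^ 2 = ENNReal.ofReal (2 * α) * (ENNReal.ofReal (t ^ (2 * α)) *
        (ENNReal.ofReal (t ^ (-(2 * α)) / (2 * α)) * KFunctional j₀ j₁ t v ^ 2)) := by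
        rw [← mul_assoc, ← mul_assoc, ← ENNReal.ofReal_mul (by positivity),
          ← ENNReal.ofReal_mul (by positivity), Real.rpow_neg ht.le]
        rw [show 2 * α * t ^ (2 * α) * ((t ^ (2 * α))⁻¹ / (2 * α)) = 1 by
          have := Real.rpow_pos_of_pos ht (2 * α)
          field_simp]
        simp
    _ ≤ _ := by gcongr

/-- The space `[X₀, X₁]_α` is of class `α`: `K(t, v) ≤ C t^α ‖v‖_α`. -/
lemma exists_KFunctional_le_interpNorm {α : ℝ} (hα : 0 < α) (hα1 : α ≤ 1) :
    ∃ C : ℝ≥0, ∀ t : ℝ, 0 < t → ∀ v : V, KFunctional j₀ j₁ t v ^ 2 ≤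
      C * (ENNReal.ofReal (t ^ (2 * α)) * interpNorm j₀ j₁ α v ^ 2) := by
  rcases hα1.lt_or_eq with h | rfl
  · refine ⟨(2 * α).toNNReal, fun t ht v => (KFunctional_sq_le_kTail j₀ j₁ hα ht v).trans ?_⟩
    rw [interpNorm_sq j₀ j₁ hα h]
    change _ ≤ ENNReal.ofReal _ * _
    gcongr
    exact lintegral_mono_set (Ioi_subset_Ioi ht.le)
  · refine ⟨1, fun t ht v => ?_⟩
    have : ENNReal.ofReal (t ^ (2 * 1 : ℝ)) = ENNReal.ofReal t ^ 2 := by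
      rw [← ENNReal.ofReal_pow ht.le]
      norm_num
    simp only [interpNorm, one_ne_zero, if_false, if_true, this, ← mul_pow, ENNReal.coe_one,
      one_mul]
    gcongr
    exact KFunctional_le_mul_imageNorm j₀ j₁ ht v

/-- The half of Holmstedt's formula that needs a construction: an almost optimal splitting
`v = a + b` for `K(t, v)` also has `b` small in `[X₀, X₁]_α`. -/
lemma exists_split_le_kTail {α : ℝ} (hα : 0 < α) (hα1 : α ≤ 1) :
    ∃ C : ℝ≥0, ∀ t : ℝ, 0 < t → ∀ v : V, KFunctional j₀ j₁ t v ≠ 0 → KFunctional j₀ j₁ t v ≠ ⊤ →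
      ∃ a b, j₀ a + j₁ b = v ∧
        ‖a‖ₑ ^ 2 + ENNReal.ofReal (t ^ (2 * α)) * interpNorm j₀ j₁ α (j₁ b) ^ 2 ≤
          C * (ENNReal.ofReal (t ^ (2 * α)) * kTail j₀ j₁ α t v) := by
  obtain ⟨D, hD⟩ : ∃ D : ℝ≥0, ∀ t : ℝ, 0 < t → ∀ v : V, ∀ a b, j₀ a + j₁ b = v →
      ‖a‖ₑ ≤ 2 * KFunctional j₀ j₁ t v →
      ENNReal.ofReal t * ‖b‖ₑ ≤ 2 * KFunctional j₀ j₁ t v →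
      ENNReal.ofReal (t ^ (2 * α)) * interpNorm j₀ j₁ α (j₁ b) ^ 2 ≤
        D * KFunctional j₀ j₁ t v ^ 2 +
          9 * (ENNReal.ofReal (t ^ (2 * α)) * kTail j₀ j₁ α t v) := by
    rcases hα1.lt_or_eq with h | rfl
    · refine ⟨(1 / (2 - 2 * α)).toNNReal * 4, fun t ht v a b hab ha hb => ?_⟩
      set K := KFunctional j₀ j₁ t v
      rw [interpNorm_sq j₀ j₁ hα h, ← Ioc_union_Ioi_eq_Ioi ht.le,
        lintegral_union measurableSet_Ioi Ioc_disjoint_Ioi_same, mul_add]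
      refine add_le_add ?_ ?_
      · -- For `s ≤ t`, use `K(s, b) ≤ s ‖b‖`.
        have h1 : ∫⁻ s in Ioc 0 t, ENNReal.ofReal (s ^ (-(2 * α) - 1)) *
            KFunctional j₀ j₁ s (j₁ b) ^ 2 ≤
            ENNReal.ofReal (t ^ (2 - 2 * α) / (2 - 2 * α)) * ‖b‖ₑ ^ 2 := by
          rw [← lintegral_Ioc_rpow (by linarith) ht.le, ← lintegral_mul_const _
            (measurable_ofReal_rpow _)]
          refine setLIntegral_mono' measurableSet_Ioc fun s hs => ?_
          calc ENNReal.ofReal (s ^ (-(2 * α) - 1)) * KFunctional j₀ j₁ s (j₁ b) ^ 2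
              ≤ ENNReal.ofReal (s ^ (-(2 * α) - 1)) * (ENNReal.ofReal s * ‖b‖ₑ) ^ 2 := by
                gcongr
                exact KFunctional_right_le j₀ j₁ s b
            _ = ENNReal.ofReal (s ^ (-(2 * α) - 1)) * ENNReal.ofReal (s ^ (2 : ℝ)) *
                  ‖b‖ₑ ^ 2 := by
                rw [mul_pow, ← ENNReal.ofReal_pow hs.1.le, Real.rpow_two, mul_assoc]
            _ = _ := by
                rw [ofReal_rpow_mul hs.1]
                congr 3
                ring
        have h2 : ENNReal.ofReal (t ^ (2 * α)) *
            ENNReal.ofReal (t ^ (2 - 2 * α) / (2 - 2 * α)) =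
            ENNReal.ofReal (1 / (2 - 2 * α)) * ENNReal.ofReal t ^ 2 := by
          have h3 : 0 < 2 - 2 * α := by linarith
          rw [← ENNReal.ofReal_pow ht.le, ← ENNReal.ofReal_mul (by positivity),
            ← ENNReal.ofReal_mul (by positivity), mul_div_assoc', ← Real.rpow_add ht]
          congr 1
          rw [show 2 * α + (2 - 2 * α) = 2 by ring, Real.rpow_two]
          ring
        calc _ ≤ ENNReal.ofReal (t ^ (2 * α)) *
              (ENNReal.ofReal (t ^ (2 - 2 * α) / (2 - 2 * α)) * ‖b‖ₑ ^ 2) := by gcongr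
          _ = ENNReal.ofReal (1 / (2 - 2 * α)) * (ENNReal.ofReal t * ‖b‖ₑ) ^ 2 := by
              rw [← mul_assoc, h2, mul_pow, mul_assoc]
          _ ≤ ENNReal.ofReal (1 / (2 - 2 * α)) * (2 * K) ^ 2 := by gcongr
          _ = _ := by
              rw [mul_pow, ENNReal.coe_mul, ENNReal.ofReal]
              norm_num
              ring
      · -- For `s > t`, use `K(s, b) ≤ K(s, v) + ‖a‖ ≤ 3 K(s, v)`.
        rw [mul_left_comm]
        gcongr
        unfold kTail
        rw [← lintegral_const_mul' _ _ (by norm_num)]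
        refine setLIntegral_mono' measurableSet_Ioi fun s hs => ?_
        have h1 : KFunctional j₀ j₁ s (j₁ b) ≤ 3 * KFunctional j₀ j₁ s v := by
          have hKs : K ≤ KFunctional j₀ j₁ s v := KFunctional_mono j₀ j₁ v (le_of_lt hs)
          calc KFunctional j₀ j₁ s (j₁ b) = KFunctional j₀ j₁ s (v + j₀ (-a)) := by
                rw [← hab, map_neg]; congr 1; abel
            _ ≤ KFunctional j₀ j₁ s v + ‖-a‖ₑ :=
                (KFunctional_add_le _ _ _ _ _).trans
                  (add_le_add le_rfl (KFunctional_left_le _ _ _ _))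
            _ ≤ KFunctional j₀ j₁ s v + 2 * KFunctional j₀ j₁ s v := by
                rw [enorm_neg]
                gcongr
                exact ha.trans (by gcongr)
            _ = _ := by ring
        calc _ ≤ ENNReal.ofReal (s ^ (-(2 * α) - 1)) * (3 * KFunctional j₀ j₁ s v) ^ 2 := by
              gcongr
          _ = _ := by ring
    · refine ⟨4, fun t ht v a b hab ha hb => le_add_right ?_⟩
      have h1 : ENNReal.ofReal (t ^ (2 * 1 : ℝ)) = ENNReal.ofReal t ^ 2 := by
        rw [← ENNReal.ofReal_pow ht.le]
        norm_num
      simp only [interpNorm, one_ne_zero, if_false, if_true, h1, ← mul_pow]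
      calc (ENNReal.ofReal t * imageNorm j₁ (j₁ b)) ^ 2
          ≤ (ENNReal.ofReal t * ‖b‖ₑ) ^ 2 := by
            gcongr
            exact imageNorm_apply_le j₁ b
        _ ≤ (2 * KFunctional j₀ j₁ t v) ^ 2 := by gcongr
        _ = _ := by
            rw [mul_pow]
            norm_num
  refine ⟨(4 + D) * (2 * α).toNNReal + 9, fun t ht v h0 htop => ?_⟩
  have hlt : KFunctional j₀ j₁ t v < 2 * KFunctional j₀ j₁ t v := by
    rw [two_mul]
    exact ENNReal.lt_add_right htop h0
  conv_lhs at hlt => unfold KFunctional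
  simp only [iInf_lt_iff] at hlt
  obtain ⟨a, b, hab, hlt⟩ := hlt
  have ha : ‖a‖ₑ ≤ 2 * KFunctional j₀ j₁ t v := le_self_add.trans hlt.le
  refine ⟨a, b, hab, ?_⟩
  calc _ ≤ (2 * KFunctional j₀ j₁ t v) ^ 2 + (D * KFunctional j₀ j₁ t v ^ 2 +
          9 * (ENNReal.ofReal (t ^ (2 * α)) * kTail j₀ j₁ α t v)) := by
        gcongr
        exact hD t ht v a b hab ha (le_add_self.trans hlt.le)
    _ = (4 + D) * KFunctional j₀ j₁ t v ^ 2 +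
          9 * (ENNReal.ofReal (t ^ (2 * α)) * kTail j₀ j₁ α t v) := by ring
    _ ≤ (4 + D) * (ENNReal.ofReal (2 * α) *
          (ENNReal.ofReal (t ^ (2 * α)) * kTail j₀ j₁ α t v)) +
          9 * (ENNReal.ofReal (t ^ (2 * α)) * kTail j₀ j₁ α t v) := by
        gcongr
        exact KFunctional_sq_le_kTail j₀ j₁ hα ht v
    _ = _ := by
        rw [ENNReal.ofReal]
        push_cast
        ring

/-- Tonelli's theorem for the tails of the interpolation integral. -/
lemma lintegral_kTail {σ α : ℝ} (hσ : σ < α) (v : V) :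
    ∫⁻ t in Ioi (0 : ℝ), ENNReal.ofReal (t ^ (-(2 * σ) - 1)) *
        (ENNReal.ofReal (t ^ (2 * α)) * kTail j₀ j₁ α t v) =
      ENNReal.ofReal (1 / (2 * (α - σ))) * ∫⁻ s in Ioi (0 : ℝ),
        ENNReal.ofReal (s ^ (-(2 * σ) - 1)) * KFunctional j₀ j₁ s v ^ 2 := by
  set g : ℝ → ℝ≥0∞ := fun s =>
    ENNReal.ofReal (s ^ (-(2 * α) - 1)) * KFunctional j₀ j₁ s v ^ 2 with hg
  have hgm : Measurable g := (measurable_ofReal_rpow _).mul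
    ((measurable_KFunctional j₀ j₁ v).pow_const 2)
  set f : ℝ → ℝ → ℝ≥0∞ := fun t s =>
    {p : ℝ × ℝ | p.1 < p.2}.indicator
      (fun p => ENNReal.ofReal (p.1 ^ (2 * (α - σ) - 1)) * g p.2) (t, s) with hf
  have hfm : Measurable (Function.uncurry f) :=
    (((measurable_ofReal_rpow _).comp measurable_fst).mul (hgm.comp measurable_snd)).indicator
      (measurableSet_lt measurable_fst measurable_snd)
  have h1 : ∀ t ∈ Ioi (0 : ℝ), ENNReal.ofReal (t ^ (-(2 * σ) - 1)) *
      (ENNReal.ofReal (t ^ (2 * α)) * kTail j₀ j₁ α t v) = ∫⁻ s in Ioi (0 : ℝ), f t s := by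
    intro t ht
    have ht : (0 : ℝ) < t := ht
    have : ∀ s, f t s = (Ioi t).indicator
        (fun s => ENNReal.ofReal (t ^ (2 * (α - σ) - 1)) * g s) s := fun s => rfl
    simp only [this]
    rw [lintegral_indicator measurableSet_Ioi, Measure.restrict_restrict measurableSet_Ioi,
      inter_eq_left.2 (Ioi_subset_Ioi ht.le), lintegral_const_mul _ hgm, ← mul_assoc,
      ofReal_rpow_mul ht]
    unfold kTail
    congr 3
    ring
  have h2 : ∀ s ∈ Ioi (0 : ℝ), ∫⁻ t in Ioi (0 : ℝ), f t s =
      ENNReal.ofReal (1 / (2 * (α - σ))) *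
        (ENNReal.ofReal (s ^ (-(2 * σ) - 1)) * KFunctional j₀ j₁ s v ^ 2) := by
    intro s hs
    have hs : (0 : ℝ) < s := hs
    have : ∀ t, f t s = (Iio s).indicator
        (fun t => ENNReal.ofReal (t ^ (2 * (α - σ) - 1)) * g s) t := fun t => rfl
    simp only [this]
    rw [lintegral_indicator measurableSet_Iio, Measure.restrict_restrict measurableSet_Iio,
      inter_comm, Ioi_inter_Iio, setLIntegral_congr Ioo_ae_eq_Ioc,
      lintegral_mul_const _ (measurable_ofReal_rpow _),
      lintegral_Ioc_rpow (by linarith) hs.le, hg]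
    dsimp only
    rw [← mul_assoc, ← mul_assoc, div_eq_mul_one_div, mul_comm (s ^ _),
      ENNReal.ofReal_mul (by apply one_div_nonneg.2; linarith), mul_assoc (ENNReal.ofReal _),
      ofReal_rpow_mul hs]
    congr 3
    ring_nf
  rw [setLIntegral_congr_fun measurableSet_Ioi h1,
    lintegral_lintegral_swap hfm.aemeasurable, setLIntegral_congr_fun measurableSet_Ioi h2,
    lintegral_const_mul' _ _ ENNReal.ofReal_ne_top]

end KFunctional

/-! ### Extended norms -/

/-- Two extended norms on the same space, each bounded by a multiple of the other. In particular
they are finite on the same subspace. -/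
def NormEquiv {V : Type*} (N M : V → ℝ≥0∞) : Prop :=
  ∃ C : ℝ≥0, ∀ v, N v ≤ C * M v ∧ M v ≤ C * N v

lemma NormEquiv.intro {V : Type*} {N M : V → ℝ≥0∞} {C D : ℝ≥0} (h : ∀ v, N v ≤ C * M v)
    (h' : ∀ v, M v ≤ D * N v) : NormEquiv N M := by
  refine ⟨max C D, fun v => ⟨(h v).trans ?_, (h' v).trans ?_⟩⟩ <;> gcongr <;> simp

lemma ENNReal_add_sq_le (x y : ℝ≥0∞) : (x + y) ^ 2 ≤ 2 * (x ^ 2 + y ^ 2) := by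
  by_cases hx : x = ⊤
  · simp [hx]
  by_cases hy : y = ⊤
  · simp [hy]
  lift x to ℝ≥0 using hx
  lift y to ℝ≥0 using hy
  have : (x + y) ^ 2 ≤ 2 * (x ^ 2 + y ^ 2) := add_sq_le
  exact_mod_cast this

lemma ENNReal_sq_add_sq_le (x y : ℝ≥0∞) : x ^ 2 + y ^ 2 ≤ (x + y) ^ 2 := by
  calc x ^ 2 + y ^ 2 ≤ x ^ 2 + y ^ 2 + 2 * x * y := le_self_add
    _ = _ := by ring

lemma le_of_sq_le {x y : ℝ≥0∞} {C : ℝ≥0} (h : x ^ 2 ≤ C * y ^ 2) :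
    x ≤ NNReal.sqrt C * y := by
  have h1 : (C : ℝ≥0∞) * y ^ 2 = (NNReal.sqrt C * y) ^ 2 := by
    rw [mul_pow, ← ENNReal.coe_pow, NNReal.sq_sqrt]
  rw [h1] at h
  exact (ENNReal.pow_le_pow_left_iff two_ne_zero).1 h

lemma sq_le_of_le {x y : ℝ≥0∞} {C : ℝ≥0} (h : x ≤ C * y) : x ^ 2 ≤ (C ^ 2 : ℝ≥0) * y ^ 2 := by
  rw [ENNReal.coe_pow, ← mul_pow]
  gcongr

lemma NormEquiv.of_sq {V : Type*} {N M : V → ℝ≥0∞} {C D : ℝ≥0}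
    (h : ∀ v, N v ^ 2 ≤ C * M v ^ 2) (h' : ∀ v, M v ^ 2 ≤ D * N v ^ 2) : NormEquiv N M :=
  .intro (fun v => le_of_sq_le (h v)) fun v => le_of_sq_le (h' v)

section

variable {X₀ X₁ V : Type*} [NormedAddCommGroup X₀] [NormedSpace ℝ X₀] [NormedAddCommGroup X₁]
  [NormedSpace ℝ X₁] [AddCommGroup V] [Module ℝ V] {j₀ : X₀ →ₗ[ℝ] V} {j₁ : X₁ →ₗ[ℝ] V}

/-- A bound for the square of the K-functional from below, through all splittings. The constant `C` is
enlarged so that it can be divided by. -/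
lemma le_mul_KFunctional_sq {x : ℝ≥0∞} {C : ℝ≥0} {t : ℝ} {v : V}
    (h : ∀ a b, j₀ a + j₁ b = v → x ≤ C * (‖a‖ₑ ^ 2 + (ENNReal.ofReal t * ‖b‖ₑ) ^ 2)) :
    x ≤ (C + 1 : ℝ≥0) * KFunctional j₀ j₁ t v ^ 2 := by
  have hC0 : ((C + 1 : ℝ≥0) : ℝ≥0∞) ≠ 0 := by simp
  have hC1 : ((C + 1 : ℝ≥0) : ℝ≥0∞) ≠ ⊤ := by simp
  rw [mul_comm, ← ENNReal.div_le_iff hC0 hC1]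
  have key : (x / (C + 1 : ℝ≥0)) ^ (2 : ℝ)⁻¹ ≤ KFunctional j₀ j₁ t v := by
    refine le_iInf₂ fun a b => le_iInf fun hab => ?_
    rw [ENNReal.rpow_inv_le_iff two_pos, ENNReal.div_le_iff hC0 hC1, mul_comm, ENNReal.rpow_two]
    refine (h a b hab).trans ?_
    gcongr
    · simp
    · exact ENNReal_sq_add_sq_le _ _
  calc x / (C + 1 : ℝ≥0) = ((x / (C + 1 : ℝ≥0)) ^ (2 : ℝ)⁻¹) ^ 2 := by
        rw [← ENNReal.rpow_natCast, ← ENNReal.rpow_mul]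
        norm_num
    _ ≤ _ := by gcongr

end

/-! ### The scale of spaces defined by the eigenfunctions -/

section Spectral

variable {d : ℕ} {Ω : Set (E d)} {μ : ℕ → ℝ} {ψ : ℕ → H10 Ω}

lemma dotNorm_sq (μ : ℕ → ℝ) (ψ : ℕ → H10 Ω) (s : ℝ) (F : Hm1 Ω) : dotNorm μ ψ s F ^ 2 =
    ∑' i, ENNReal.ofReal ((μ i) ^ (-s) * (F ((μ i) ^ (1 / 2 : ℝ) • ψ i)) ^ 2) := by
  rw [dotNorm, ← ENNReal.rpow_natCast, ← ENNReal.rpow_mul]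
  norm_num

/-- The sum `∑_i min(1, (t² / μ_i)^α) μ_i^{-p} ⟨F, ψ̃_i⟩²`, a diagonal substitute for the square of
the K-functional of the couple `Ḣ^p, Ḣ^{p+α}` at the parameter `t^α`. -/
noncomputable def spectralK (μ : ℕ → ℝ) (ψ : ℕ → H10 Ω) (p α t : ℝ) (F : Hm1 Ω) : ℝ≥0∞ :=
  ∑' i, ENNReal.ofReal (min 1 ((t ^ 2 / μ i) ^ α) *
    ((μ i) ^ (-p) * (F ((μ i) ^ (1 / 2 : ℝ) • ψ i)) ^ 2))

lemma rpow_sq_div {m t : ℝ} (hm : 0 < m) (ht : 0 < t) (α : ℝ) :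
    (t ^ 2 / m) ^ α = t ^ (2 * α) * m ^ (-α) := by
  rw [Real.div_rpow (by positivity) hm.le, ← Real.rpow_natCast, ← Real.rpow_mul ht.le,
    Real.rpow_neg hm.le]
  rfl

/-- `spectralK` is bounded by every splitting, up to the factor `2`. -/
lemma spectralK_le (hμ : ∀ i, 0 < μ i) {p α t : ℝ} (ht : 0 < t) (F G : Hm1 Ω) :
    spectralK μ ψ p α t (F + G) ≤ 2 * (dotNorm μ ψ p F ^ 2 +
      ENNReal.ofReal (t ^ (2 * α)) * dotNorm μ ψ (p + α) G ^ 2) := by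
  rw [dotNorm_sq, dotNorm_sq, ← ENNReal.tsum_mul_left, ← ENNReal.tsum_add,
    ← ENNReal.tsum_mul_left]
  refine ENNReal.tsum_le_tsum fun i => ?_
  have hp : 0 < (μ i) ^ (-p) := Real.rpow_pos_of_pos (hμ i) _
  have ha : 0 < (μ i) ^ (-α) := Real.rpow_pos_of_pos (hμ i) _
  have hpa : (μ i) ^ (-(p + α)) = (μ i) ^ (-p) * (μ i) ^ (-α) := by
    rw [← Real.rpow_add (hμ i)]; congr 1; ring
  have hta : 0 < t ^ (2 * α) := Real.rpow_pos_of_pos ht _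
  have htwo : ∀ r : ℝ, 2 * ENNReal.ofReal r = ENNReal.ofReal (2 * r) := fun r => by
    rw [ENNReal.ofReal_mul zero_le_two, ENNReal.ofReal_ofNat]
  rw [hpa, rpow_sq_div (hμ i) ht, ← ENNReal.ofReal_mul hta.le,
    ← ENNReal.ofReal_add (by positivity) (by positivity), htwo]
  refine ENNReal.ofReal_le_ofReal ?_
  rw [_root_.add_apply]
  set x := F ((μ i) ^ (1 / 2 : ℝ) • ψ i)
  set y := G ((μ i) ^ (1 / 2 : ℝ) • ψ i)
  set m := min 1 (t ^ (2 * α) * μ i ^ (-α))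
  have hm0 : 0 ≤ m := le_min zero_le_one (by positivity)
  have h1 : m * x ^ 2 ≤ 1 * x ^ 2 := by gcongr; exact min_le_left _ _
  have h2 : m * y ^ 2 ≤ (t ^ (2 * α) * μ i ^ (-α)) * y ^ 2 := by gcongr; exact min_le_right _ _
  have h3 : m * (x + y) ^ 2 ≤ m * (2 * (x ^ 2 + y ^ 2)) := by gcongr; exact add_sq_le
  calc m * (μ i ^ (-p) * (x + y) ^ 2) = μ i ^ (-p) * (m * (x + y) ^ 2) := by ring
    _ ≤ μ i ^ (-p) * (2 * (1 * x ^ 2 + (t ^ (2 * α) * μ i ^ (-α)) * y ^ 2)) := by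
      refine mul_le_mul_of_nonneg_left ?_ hp.le
      linarith
    _ = _ := by ring

/-- Each term of `spectralK` is integrated separately, over `t ≤ μ_i^{1/2}` and `t > μ_i^{1/2}`. -/
lemma lintegral_spectralK (hμ : ∀ i, 0 < μ i) {p σ α : ℝ} (hσ : 0 < σ) (hσα : σ < α)
    (F : Hm1 Ω) :
    ∫⁻ t in Ioi (0 : ℝ), ENNReal.ofReal (t ^ (-(2 * σ) - 1)) * spectralK μ ψ p α t F =
      ENNReal.ofReal (1 / (2 * (α - σ)) + 1 / (2 * σ)) * dotNorm μ ψ (p + σ) F ^ 2 := by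
  have hασ : 0 < α - σ := sub_pos.2 hσα
  simp only [spectralK, ← ENNReal.tsum_mul_left]
  rw [lintegral_tsum fun i => by fun_prop, dotNorm_sq, ← ENNReal.tsum_mul_left]
  congr 1
  ext i
  set w := F ((μ i) ^ (1 / 2 : ℝ) • ψ i) ^ 2
  have hw : 0 ≤ w := sq_nonneg _
  have hm := hμ i
  set m := μ i
  set c := m ^ (1 / 2 : ℝ) with hc
  have hc0 : 0 < c := Real.rpow_pos_of_pos hm _
  have hcm : ∀ β : ℝ, c ^ (2 * β) = m ^ β := fun β => by
    rw [hc, ← Real.rpow_mul hm.le]; congr 1; ring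
  have hcsq : c ^ 2 = m := by
    rw [hc, ← Real.rpow_natCast, ← Real.rpow_mul hm.le]; norm_num
  have hmp : 0 ≤ m ^ (-p) := Real.rpow_nonneg hm.le _
  rw [← Ioc_union_Ioi_eq_Ioi hc0.le, lintegral_union measurableSet_Ioi Ioc_disjoint_Ioi_same]
  have h1 : ∀ t ∈ Ioc 0 c, ENNReal.ofReal (t ^ (-(2 * σ) - 1)) *
      ENNReal.ofReal (min 1 ((t ^ 2 / m) ^ α) * (m ^ (-p) * w)) =
      ENNReal.ofReal (t ^ (2 * (α - σ) - 1)) * ENNReal.ofReal (m ^ (-α) * (m ^ (-p) * w)) := by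
    intro t ht
    have hle : t ^ 2 / m ≤ 1 := by
      rw [div_le_one hm, ← hcsq]
      exact pow_le_pow_left₀ ht.1.le ht.2 2
    have : (t ^ 2 / m) ^ α ≤ 1 :=
      Real.rpow_le_one (div_nonneg (sq_nonneg t) hm.le) hle (hσ.trans hσα).le
    rw [min_eq_right this, rpow_sq_div hm ht.1, mul_assoc,
      ENNReal.ofReal_mul (Real.rpow_nonneg ht.1.le _), ← mul_assoc, ofReal_rpow_mul ht.1]
    congr 3
    ring
  have h2 : ∀ t ∈ Ioi c, ENNReal.ofReal (t ^ (-(2 * σ) - 1)) *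
      ENNReal.ofReal (min 1 ((t ^ 2 / m) ^ α) * (m ^ (-p) * w)) =
      ENNReal.ofReal (t ^ (-(2 * σ) - 1)) * ENNReal.ofReal (m ^ (-p) * w) := by
    intro t ht
    have hle : 1 ≤ t ^ 2 / m := by
      rw [one_le_div hm, ← hcsq]
      exact pow_le_pow_left₀ hc0.le (le_of_lt ht) 2
    rw [min_eq_left (Real.one_le_rpow hle (hσ.trans hσα).le), one_mul]
  rw [setLIntegral_congr_fun measurableSet_Ioc h1, setLIntegral_congr_fun measurableSet_Ioi h2,
    lintegral_mul_const _ (measurable_ofReal_rpow _),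
    lintegral_mul_const _ (measurable_ofReal_rpow _), lintegral_Ioc_rpow (by linarith) hc0.le,
    lintegral_Ioi_rpow (by linarith) hc0, ← ENNReal.ofReal_mul (by positivity),
    ← ENNReal.ofReal_mul (by positivity), ← ENNReal.ofReal_add (by positivity) (by positivity),
    ← ENNReal.ofReal_mul (by positivity)]
  congr 1
  rw [hcm, show -(2 * σ) = 2 * (-σ) by ring, hcm, show -(p + σ) = -p + -σ by ring,
    Real.rpow_add hm, sub_eq_add_neg, Real.rpow_add hm, Real.rpow_neg hm.le α]
  have : 0 < m ^ α := Real.rpow_pos_of_pos hm _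
  field_simp

variable {A : Sobolev Ω 1 →L[ℝ] H10 Ω →L[ℝ] ℝ} {hA : IsCoercive (restrictForm A)}

/-- The functions `ψ̃_i` are orthonormal in `L²(Ω)`. -/
lemma IsEigenbasis.toHm1_apply (h : IsEigenbasis A hA μ ψ) (i j : ℕ) :
    H10.toHm1 Ω ((μ i) ^ (1 / 2 : ℝ) • ψ i) ((μ j) ^ (1 / 2 : ℝ) • ψ j) =
      if i = j then 1 else 0 := by
  have h1 := h.orthonormal i j
  rw [h.eigen, map_smul, smul_eq_mul] at h1
  rw [map_smul, map_smul, _root_.smul_apply, smul_eq_mul, smul_eq_mul]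
  rcases eq_or_ne i j with rfl | hij
  · rw [← mul_assoc, ← Real.rpow_add (h.pos i)]
    norm_num
    simpa using h1
  · rw [if_neg hij] at h1 ⊢
    simp [(mul_eq_zero.1 h1).resolve_left (h.pos j).ne']

/-- The functional `spectralK` is attained, up to a factor, by a splitting along the eigenfunctions:
the finitely many components with `t² ≤ μ_i` are put in the smoother space. -/
lemma IsEigenbasis.exists_split (h : IsEigenbasis A hA μ ψ) {p α t : ℝ} (hα : 0 < α) (ht : 0 < t)
    (F : Hm1 Ω) : ∃ G G' : Hm1 Ω, G + G' = F ∧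
      dotNorm μ ψ p G ^ 2 + ENNReal.ofReal (t ^ (2 * α)) * dotNorm μ ψ (p + α) G' ^ 2 =
        spectralK μ ψ p α t F := by
  have hfin : {i | t ^ 2 ≤ μ i}.Finite := by
    have := h.tendsto.eventually (gt_mem_nhds (show (0 : ℝ) < t ^ 2 by positivity))
    rw [← Nat.cofinite_eq_atTop, eventually_cofinite] at this
    simpa using this
  set G' : Hm1 Ω := ∑ i ∈ hfin.toFinset,
    F ((μ i) ^ (1 / 2 : ℝ) • ψ i) • H10.toHm1 Ω ((μ i) ^ (1 / 2 : ℝ) • ψ i) with hG'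
  have hc : ∀ j, G' ((μ j) ^ (1 / 2 : ℝ) • ψ j) =
      if t ^ 2 ≤ μ j then F ((μ j) ^ (1 / 2 : ℝ) • ψ j) else 0 := by
    intro j
    rw [hG', _root_.sum_apply]
    simp only [_root_.smul_apply, h.toHm1_apply, smul_eq_mul, mul_ite, mul_one,
      mul_zero, Finset.sum_ite_eq', Finite.mem_toFinset, mem_ofPred_eq]
  refine ⟨F - G', G', sub_add_cancel _ _, ?_⟩
  rw [dotNorm_sq, dotNorm_sq, ← ENNReal.tsum_mul_left, ← ENNReal.tsum_add]
  congr 1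
  ext i
  have hm := h.pos i
  rw [_root_.sub_apply, hc]
  split_ifs with hi
  · have : (t ^ 2 / μ i) ^ α ≤ 1 := Real.rpow_le_one (by positivity) ((div_le_one hm).2 hi) hα.le
    rw [min_eq_right this, rpow_sq_div hm ht, sub_self, ← ENNReal.ofReal_mul (by positivity),
      show -(p + α) = -p + -α by ring, Real.rpow_add hm]
    simp only [ne_eq, OfNat.ofNat_ne_zero, not_false_eq_true, zero_pow, mul_zero,
      ENNReal.ofReal_zero, zero_add]
    congr 1
    ring
  · have : 1 ≤ (t ^ 2 / μ i) ^ α :=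
      Real.one_le_rpow ((one_le_div hm).2 (not_le.1 hi).le) hα.le
    simp [min_eq_left this]

end Spectral

section Interp

variable {d : ℕ} {Ω : Set (E d)} {μ : ℕ → ℝ} {ψ : ℕ → H10 Ω}
  {A : Sobolev Ω 1 →L[ℝ] H10 Ω →L[ℝ] ℝ} {hA : IsCoercive (restrictForm A)}
  {X₀ X₁ : Type*} [NormedAddCommGroup X₀] [NormedSpace ℝ X₀] [NormedAddCommGroup X₁]
  [NormedSpace ℝ X₁] {j₀ : X₀ →ₗ[ℝ] Hm1 Ω} {j₁ : X₁ →ₗ[ℝ] Hm1 Ω}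

/-- Interpolation in the spectral scale: if the two spaces are `Ḣ^p` and `Ḣ^{p+1}`, then the
interpolation space with exponent `θ` is `Ḣ^{p+θ}`. -/
lemma IsEigenbasis.normEquiv_interpNorm (h : IsEigenbasis A hA μ ψ) {p θ : ℝ}
    (h₀ : NormEquiv (imageNorm j₀) (dotNorm μ ψ p))
    (h₁ : NormEquiv (imageNorm j₁) (dotNorm μ ψ (p + 1))) (hθ : 0 < θ) (hθ1 : θ < 1) :
    NormEquiv (interpNorm j₀ j₁ θ) (dotNorm μ ψ (p + θ)) := by
  obtain ⟨C₀, hC₀⟩ := h₀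
  obtain ⟨C₁, hC₁⟩ := h₁
  have ht1 : ∀ t : ℝ, 0 < t → ENNReal.ofReal (t ^ (2 * 1 : ℝ)) = ENNReal.ofReal t ^ 2 := by
    intro t ht
    rw [← ENNReal.ofReal_pow ht.le]
    norm_num
  have hup : ∀ t : ℝ, 0 < t → ∀ F, KFunctional j₀ j₁ t F ^ 2 ≤
      (2 * (C₀ ^ 2 + C₁ ^ 2) : ℝ≥0) * spectralK μ ψ p 1 t F := by
    intro t ht F
    obtain ⟨G, G', rfl, hG⟩ := h.exists_split (p := p) one_pos ht F
    rw [← hG]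
    calc KFunctional j₀ j₁ t (G + G') ^ 2
        ≤ (imageNorm j₀ G + ENNReal.ofReal t * imageNorm j₁ G') ^ 2 := by
          gcongr
          exact (KFunctional_add_le _ _ _ _ _).trans (add_le_add (KFunctional_le_imageNorm _ _ _ _)
            (KFunctional_le_mul_imageNorm _ _ ht _))
      _ ≤ 2 * (imageNorm j₀ G ^ 2 + ENNReal.ofReal t ^ 2 * imageNorm j₁ G' ^ 2) := by
          rw [← mul_pow]
          exact ENNReal_add_sq_le _ _
      _ ≤ 2 * ((C₀ ^ 2 + C₁ ^ 2 : ℝ≥0) * dotNorm μ ψ p G ^ 2 +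
            ENNReal.ofReal t ^ 2 * ((C₀ ^ 2 + C₁ ^ 2 : ℝ≥0) * dotNorm μ ψ (p + 1) G' ^ 2)) := by
          gcongr
          · refine (sq_le_of_le (hC₀ G).1).trans ?_
            gcongr
            simp
          · refine (sq_le_of_le (hC₁ G').1).trans ?_
            gcongr
            simp
      _ = _ := by
          rw [ht1 t ht]
          push_cast
          ring
  have hlow : ∀ t : ℝ, 0 < t → ∀ F, spectralK μ ψ p 1 t F ≤
      (2 * (C₀ ^ 2 + C₁ ^ 2) + 1 : ℝ≥0) * KFunctional j₀ j₁ t F ^ 2 := by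
    intro t ht F
    refine le_mul_KFunctional_sq fun a b hab => ?_
    rw [← hab]
    refine (spectralK_le h.pos ht _ _).trans ?_
    calc _ ≤ 2 * ((C₀ ^ 2 + C₁ ^ 2 : ℝ≥0) * ‖a‖ₑ ^ 2 +
            ENNReal.ofReal t ^ 2 * ((C₀ ^ 2 + C₁ ^ 2 : ℝ≥0) * ‖b‖ₑ ^ 2)) := by
          rw [ht1 t ht]
          gcongr
          · refine (sq_le_of_le (hC₀ _).2).trans ?_
            gcongr
            · simp
            · exact imageNorm_apply_le _ _
          · refine (sq_le_of_le (hC₁ _).2).trans ?_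
            gcongr
            · simp
            · exact imageNorm_apply_le _ _
      _ = _ := by
          push_cast
          ring
  have hκ : (0 : ℝ) < 1 / (2 * (1 - θ)) + 1 / (2 * θ) := by
    have : 0 < 1 - θ := by linarith
    positivity
  have hint := fun F => lintegral_spectralK (ψ := ψ) h.pos (p := p) hθ hθ1 F
  set κ : ℝ := 1 / (2 * (1 - θ)) + 1 / (2 * θ)
  refine NormEquiv.of_sq (C := 2 * (C₀ ^ 2 + C₁ ^ 2) * κ.toNNReal)
    (D := κ⁻¹.toNNReal * (2 * (C₀ ^ 2 + C₁ ^ 2) + 1)) (fun F => ?_) fun F => ?_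
  · rw [interpNorm_sq _ _ hθ hθ1, ENNReal.coe_mul, mul_assoc]
    change _ ≤ _ * (ENNReal.ofReal κ * _)
    rw [← hint, ← lintegral_const_mul' _ _ ENNReal.coe_ne_top]
    refine setLIntegral_mono' measurableSet_Ioi fun t ht => ?_
    rw [mul_left_comm]
    gcongr
    exact hup t ht F
  · rw [interpNorm_sq _ _ hθ hθ1, ENNReal.coe_mul, mul_assoc]
    have : dotNorm μ ψ (p + θ) F ^ 2 = ENNReal.ofReal κ⁻¹ *
        (ENNReal.ofReal κ * dotNorm μ ψ (p + θ) F ^ 2) := by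
      rw [← mul_assoc, ← ENNReal.ofReal_mul (by positivity), inv_mul_cancel₀ hκ.ne']
      simp
    rw [this, ← hint]
    change ENNReal.ofReal κ⁻¹ * _ ≤ ENNReal.ofReal κ⁻¹ * _
    gcongr
    rw [← lintegral_const_mul' _ _ ENNReal.coe_ne_top]
    refine setLIntegral_mono' measurableSet_Ioi fun t ht => ?_
    rw [mul_left_comm]
    gcongr
    exact hlow t ht F

end Interp

/-! ### The energy inner product -/

section Energy

universe u

variable {V : Type u} [NormedAddCommGroup V] [InnerProductSpace ℝ V]

/-- The Hilbert space `V` with a symmetric coercive form `a` as its inner product. Its topology is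
that of `V`. A copy of `V` is needed, as `V` already has another inner product. -/
def EnergySpace (a : V →L[ℝ] V →L[ℝ] ℝ) (_ : ∀ u v, a u v = a v u) (_ : IsCoercive a) : Type u :=
  V

variable {a : V →L[ℝ] V →L[ℝ] ℝ} {hs : ∀ u v, a u v = a v u} {hc : IsCoercive a}

instance : AddCommGroup (EnergySpace a hs hc) := inferInstanceAs (AddCommGroup V)
instance : Module ℝ (EnergySpace a hs hc) := inferInstanceAs (Module ℝ V)
instance : TopologicalSpace (EnergySpace a hs hc) := inferInstanceAs (TopologicalSpace V)
instance : IsTopologicalAddGroup (EnergySpace a hs hc) :=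
  inferInstanceAs (IsTopologicalAddGroup V)
instance : ContinuousConstSMul ℝ (EnergySpace a hs hc) :=
  inferInstanceAs (ContinuousConstSMul ℝ V)

variable (a hs hc) in
/-- The inner product given by the form `a`. -/
@[reducible] noncomputable def energyCore : InnerProductSpace.Core ℝ (EnergySpace a hs hc) where
  inner u v := a u v
  conj_inner_symm u v := hs v u
  re_inner_nonneg (u : V) := by
    obtain ⟨C, hC, h⟩ := hc
    exact (by positivity : 0 ≤ C * ‖u‖ * ‖u‖).trans (h u)
  add_left (u v w : V) := DFunLike.congr_fun (map_add a u v) w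
  smul_left (u v : V) r := DFunLike.congr_fun (map_smul a r u) v
  definite (u : V) hu := by
    obtain ⟨C, hC, h⟩ := hc
    have h1 : C * ‖u‖ * ‖u‖ ≤ 0 := (h u).trans (le_of_eq hu)
    by_contra hne
    have : 0 < ‖u‖ := norm_pos_iff.2 hne
    have : 0 < C * ‖u‖ * ‖u‖ := by positivity
    linarith

lemma energyCore_continuousAt :
    ContinuousAt (fun v : EnergySpace a hs hc => (energyCore a hs hc).inner v v) 0 := by
  have : Continuous fun v : V => a v v := by fun_prop
  exact this.continuousAt

lemma energyCore_isVonNBounded : Bornology.IsVonNBounded ℝ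
    {v : EnergySpace a hs hc | RCLike.re ((energyCore a hs hc).inner v v) < 1} := by
  change Bornology.IsVonNBounded ℝ {v : V | a v v < 1}
  obtain ⟨C, hC, h⟩ := hc
  rw [NormedSpace.isVonNBounded_iff, isBounded_iff_forall_norm_le]
  refine ⟨1 + 1 / C, fun v hv => ?_⟩
  have h1 : C * ‖v‖ * ‖v‖ < 1 := (h v).trans_lt hv
  by_contra! h2
  have h3 : 0 < 1 / C := by positivity
  have h4 : C * (1 / C) = 1 := by field_simp
  have h5 : C * (1 / C) ≤ C * ‖v‖ := by gcongr; linarith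
  nlinarith [norm_nonneg v]

noncomputable instance : NormedAddCommGroup (EnergySpace a hs hc) :=
  (energyCore a hs hc).toNormedAddCommGroupOfTopology energyCore_continuousAt
    energyCore_isVonNBounded

noncomputable instance : InnerProductSpace ℝ (EnergySpace a hs hc) :=
  .ofCoreOfTopology (energyCore a hs hc) energyCore_continuousAt energyCore_isVonNBounded

variable (a hs hc) in
/-- The identity, as an isomorphism of topological vector spaces. -/
def toEnergy : V ≃L[ℝ] EnergySpace a hs hc where
  toFun v := v
  invFun v := v
  map_add' _ _ := rfl
  map_smul' _ _ := rfl
  left_inv _ := rfl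
  right_inv _ := rfl
  continuous_toFun := continuous_id (X := V)
  continuous_invFun := continuous_id (X := V)

instance [CompleteSpace V] : CompleteSpace (EnergySpace a hs hc) :=
  (completeSpace_congr (e := (toEnergy a hs hc).toEquiv)
    (toEnergy a hs hc).isUniformEmbedding).1 inferInstance

/-- A symmetric coercive form is the inner product of an equivalent Hilbert space structure. -/
lemma exists_energySpace [CompleteSpace V] (a : V →L[ℝ] V →L[ℝ] ℝ) (hs : ∀ u v, a u v = a v u)
    (hc : IsCoercive a) :
    ∃ (W : Type u) (_ : NormedAddCommGroup W) (_ : InnerProductSpace ℝ W) (_ : CompleteSpace W)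
      (e : V ≃L[ℝ] W), ∀ u v, inner ℝ (e u) (e v) = a u v :=
  ⟨EnergySpace a hs hc, inferInstance, inferInstance, inferInstance, toEnergy a hs hc,
    fun _ _ => rfl⟩

end Energy

/-! ### The spaces `H^{-1}(Ω)`, `L²(Ω)` and `H^1_0(Ω)` in the spectral scale -/

section

variable {V X X' : Type*} [NormedAddCommGroup X] [NormedSpace ℝ X] [NormedAddCommGroup X']
  [NormedSpace ℝ X'] [AddCommGroup V] [Module ℝ V] {j : X →ₗ[ℝ] V} {j' : X' →ₗ[ℝ] V}

/-- The constant `C + 1` is positive, so that `C = 0` need not be excluded: the right side has to be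
`∞` off the range of `j`. -/
lemma imageNorm_le_of_forall {C : ℝ≥0} (h : ∀ x, ∃ x', j' x' = j x ∧ ‖x'‖ ≤ C * ‖x‖) (v : V) :
    imageNorm j' v ≤ (C + 1 : ℝ≥0) * imageNorm j v := by
  have h0 : ((C + 1 : ℝ≥0) : ℝ≥0∞) ≠ 0 := by simp
  rw [imageNorm, imageNorm]
  simp only [ENNReal.mul_iInf_of_ne h0 ENNReal.coe_ne_top]
  refine le_iInf₂ fun x hx => ?_
  obtain ⟨x', hx', hle⟩ := h x
  refine (iInf₂_le x' (hx'.trans hx)).trans ?_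
  rw [enorm_eq_nnnorm, enorm_eq_nnnorm, ← ENNReal.coe_mul, ENNReal.coe_le_coe]
  exact (show ‖x'‖₊ ≤ C * ‖x‖₊ from hle).trans (by gcongr; simp)

end

section

variable {d : ℕ} {Ω : Set (E d)} {μ : ℕ → ℝ} {ψ : ℕ → H10 Ω}

/-- A Hilbert space on which the coefficients `⟨F, ψ̃_i⟩` are the Fourier coefficients for a Hilbert
basis, up to the factors `μ_i^{s/2}`, is `Ḣ^s`. -/
lemma imageNorm_eq_dotNorm {X : Type*} [NormedAddCommGroup X] [InnerProductSpace ℝ X]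
    [CompleteSpace X] (b : HilbertBasis ℕ ℝ X) (j : X →ₗ[ℝ] Hm1 Ω) {s : ℝ} (hμ : ∀ i, 0 < μ i)
    (hψ : ∀ F : Hm1 Ω, (∀ i, F (ψ i) = 0) → F = 0)
    (hj : ∀ x i, j x ((μ i) ^ (1 / 2 : ℝ) • ψ i) = (μ i) ^ (s / 2) * inner ℝ (b i) x)
    (F : Hm1 Ω) : imageNorm j F = dotNorm μ ψ s F := by
  have hsum : ∀ x, HasSum (fun i => inner ℝ (b i) x ^ 2) (‖x‖ ^ 2) := by
    intro x
    have := b.hasSum_inner_mul_inner x x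
    rw [real_inner_self_eq_norm_sq] at this
    simpa only [real_inner_comm, sq] using this
  have hpow : ∀ i (c : ℝ), (μ i) ^ (-s) * ((μ i) ^ (s / 2) * c) ^ 2 = c ^ 2 := by
    intro i c
    rw [mul_pow, ← Real.rpow_natCast, ← Real.rpow_mul (hμ i).le, ← mul_assoc,
      ← Real.rpow_add (hμ i)]
    rw [show -s + s / 2 * (2 : ℕ) = 0 by push_cast; ring, Real.rpow_zero, one_mul]
  have hinj : Function.Injective j := by
    refine (injective_iff_map_eq_zero j).2 fun x hx => ?_
    have h0 : ∀ i, inner ℝ (b i) x ^ 2 = 0 := by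
      intro i
      have := hj x i
      rw [hx, _root_.zero_apply] at this
      have h1 := (mul_eq_zero.1 this.symm).resolve_left (Real.rpow_pos_of_pos (hμ i) _).ne'
      simp [h1]
    have := (hsum x).unique (by simpa only [h0] using hasSum_zero)
    simpa using this
  by_cases hF : ∃ x, j x = F
  · obtain ⟨x, rfl⟩ := hF
    rw [imageNorm_of_injective hinj]
    have h2 : dotNorm μ ψ s (j x) ^ 2 = ‖x‖ₑ ^ 2 := by
      rw [dotNorm_sq]
      simp only [hj, hpow]
      rw [← ENNReal.ofReal_tsum_of_nonneg (fun i => sq_nonneg _) (hsum x).summable,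
        (hsum x).tsum_eq, ENNReal.ofReal_pow (norm_nonneg _), ofReal_norm]
    exact le_antisymm ((ENNReal.pow_le_pow_left_iff two_ne_zero).1 h2.ge)
      ((ENNReal.pow_le_pow_left_iff two_ne_zero).1 h2.le)
  · have h1 : imageNorm j F = ⊤ := by
      by_contra h
      exact hF (exists_of_imageNorm_lt_top (lt_top_iff_ne_top.2 h))
    rw [h1]
    by_contra hne
    refine hF ?_
    have hfin : dotNorm μ ψ s F ^ 2 ≠ ⊤ := ENNReal.pow_ne_top (Ne.symm hne)
    rw [dotNorm_sq] at hfin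
    set c : ℕ → ℝ := fun i => (μ i) ^ (-(s / 2)) * F ((μ i) ^ (1 / 2 : ℝ) • ψ i) with hc
    have hmem : Memℓp c 2 := by
      refine memℓp_gen ?_
      have h2 := ENNReal.summable_toReal hfin
      refine h2.congr fun i => ?_
      rw [ENNReal.toReal_ofReal (mul_nonneg (Real.rpow_nonneg (hμ i).le _) (sq_nonneg _))]
      simp only [ENNReal.toReal_ofNat, Real.rpow_two, Real.norm_eq_abs, sq_abs, hc]
      rw [mul_pow, ← Real.rpow_natCast (_ ^ _), ← Real.rpow_mul (hμ i).le]
      congr 2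
      push_cast
      ring
    refine ⟨b.repr.symm ⟨c, hmem⟩, sub_eq_zero.1 (hψ _ fun i => ?_)⟩
    have h3 : (j (b.repr.symm ⟨c, hmem⟩) - F) ((μ i) ^ (1 / 2 : ℝ) • ψ i) = 0 := by
      rw [_root_.sub_apply, hj, ← b.repr_apply_apply, LinearIsometryEquiv.apply_symm_apply]
      change (μ i) ^ (s / 2) * ((μ i) ^ (-(s / 2)) * F ((μ i) ^ (1 / 2 : ℝ) • ψ i)) - _ = 0
      rw [← mul_assoc, ← Real.rpow_add (hμ i)]
      simp
    rw [map_smul, smul_eq_mul] at h3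
    exact (mul_eq_zero.1 h3).resolve_left (Real.rpow_pos_of_pos (hμ i) _).ne'

variable {A : Sobolev Ω 1 →L[ℝ] H10 Ω →L[ℝ] ℝ} {hA : IsCoercive (restrictForm A)}

lemma apply_solutionOp (F : Hm1 Ω) (φ : H10 Ω) : A (solutionOp A hA F) φ = F φ :=
  (solutionOp_eq_iff A hA F _).1 rfl φ

lemma exists_norm_solutionOp_le (hA : IsCoercive (restrictForm A)) :
    ∃ C : ℝ≥0, ∀ F, ‖solutionOp A hA F‖ ≤ C * ‖F‖ := by
  obtain ⟨c, hc, hcoer⟩ := id hA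
  refine ⟨⟨c⁻¹, by positivity⟩, fun F => ?_⟩
  have h1 : c * ‖solutionOp A hA F‖ * ‖solutionOp A hA F‖ ≤ ‖F‖ * ‖solutionOp A hA F‖ := by
    refine (hcoer _).trans ((le_of_eq (apply_solutionOp F _)).trans ?_)
    exact (le_abs_self _).trans (F.le_opNorm _)
  change _ ≤ c⁻¹ * _
  rw [inv_mul_eq_div, le_div_iff₀' hc]
  rcases (norm_nonneg (solutionOp A hA F)).eq_or_lt with h0 | h0
  · rw [← h0, mul_zero]
    exact norm_nonneg F
  · exact le_of_mul_le_mul_right h1 h0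

lemma toHm1_apply_eq_inner (u v : H10 Ω) :
    H10.toHm1 Ω u v = inner ℝ (H10.toL2 Ω u) (H10.toL2 Ω v) := rfl

lemma toHm1_symm (u v : H10 Ω) : H10.toHm1 Ω u v = H10.toHm1 Ω v u :=
  real_inner_comm (H10.toL2 Ω v) (H10.toL2 Ω u)

/-- The eigenvalue equation in weak form. -/
lemma IsEigenbasis.weak (h : IsEigenbasis A hA μ ψ) (i : ℕ) (v : H10 Ω) :
    μ i * A (ψ i) v = H10.toHm1 Ω (ψ i) v := by
  have := (solutionOp_eq_iff A hA _ _).1 (h.eigen i) v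
  rw [← this]
  simp

/-- The coefficients `⟨F, ψ_i⟩` determine `F`. -/
lemma IsEigenbasis.eq_zero (h : IsEigenbasis A hA μ ψ) (hs : ∀ u v : H10 Ω, A u v = A v u)
    (F : Hm1 Ω) (hF : ∀ i, F (ψ i) = 0) : F = 0 := by
  -- The functional `G ↦ ⟨G, T F⟩ = ⟨F, G⟩_{-1}` vanishes on a dense subspace.
  have hsub : (Submodule.span ℝ (range fun i => H10.toHm1 Ω (ψ i))).topologicalClosure ≤
      LinearMap.ker (ContinuousLinearMap.apply ℝ ℝ (solutionOp A hA F)).toLinearMap := by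
    refine Submodule.topologicalClosure_minimal _ (Submodule.span_le.2 ?_)
      (ContinuousLinearMap.isClosed_ker _)
    rintro _ ⟨i, rfl⟩
    change H10.toHm1 Ω (ψ i) (solutionOp A hA F) = 0
    rw [← h.weak, hs, apply_solutionOp, hF, mul_zero]
  rw [h.complete] at hsub
  have h1 : F (solutionOp A hA F) = 0 := hsub (Submodule.mem_top (x := F))
  rw [← apply_solutionOp (A := A) (hA := hA)] at h1
  have h2 : solutionOp A hA F = 0 := by
    obtain ⟨C, hC, hcoer⟩ := id hA
    have h3 : C * ‖solutionOp A hA F‖ * ‖solutionOp A hA F‖ ≤ 0 := (hcoer _).trans h1.le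
    by_contra hne
    have : 0 < ‖solutionOp A hA F‖ := norm_pos_iff.2 hne
    have : 0 < C * ‖solutionOp A hA F‖ * ‖solutionOp A hA F‖ := by positivity
    linarith
  ext φ
  rw [← apply_solutionOp (A := A) (hA := hA), h2]
  simp

lemma restrictForm_apply (A : Sobolev Ω 1 →L[ℝ] H10 Ω →L[ℝ] ℝ) (u v : H10 Ω) :
    restrictForm A u v = A u v := rfl

/-- The functions `μ_i ψ_i` are an orthonormal basis of `H^1_0(Ω)` for the energy inner product. -/
lemma IsEigenbasis.exists_energy_basis (h : IsEigenbasis A hA μ ψ)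
    (hs : ∀ u v : H10 Ω, A u v = A v u) :
    ∃ (W : Type) (_ : NormedAddCommGroup W) (_ : InnerProductSpace ℝ W) (_ : CompleteSpace W)
      (e : H10 Ω ≃L[ℝ] W) (b : HilbertBasis ℕ ℝ W),
      (∀ u v : H10 Ω, inner ℝ (e u) (e v) = A u v) ∧ ∀ i, b i = μ i • e (ψ i) := by
  obtain ⟨W, _, _, _, e, he⟩ := exists_energySpace (V := H10 Ω) (restrictForm A) hs hA
  have hon : Orthonormal ℝ fun i => μ i • e (ψ i) := by
    rw [orthonormal_iff_ite]
    intro i j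
    rw [inner_smul_left, inner_smul_right, he, restrictForm_apply, ← h.orthonormal i j,
      h.eigen j, ← h.weak, map_smul, smul_eq_mul]
    simp only [conj_trivial]
  have hsp : (Submodule.span ℝ (range fun i => μ i • e (ψ i)))ᗮ = ⊥ := by
    rw [Submodule.eq_bot_iff]
    intro w hw
    obtain ⟨u, rfl⟩ := e.surjective w
    have h1 : restrictForm A u = 0 := by
      refine h.eq_zero hs _ fun i => ?_
      have h2 : inner ℝ (e u) (μ i • e (ψ i)) = 0 :=
        (Submodule.mem_orthogonal' _ _).1 hw _ (Submodule.subset_span ⟨i, rfl⟩)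
      rw [inner_smul_right, he] at h2
      exact (mul_eq_zero.1 h2).resolve_left (h.pos i).ne'
    rw [← inner_self_eq_zero (𝕜 := ℝ), he, h1]
    rfl
  exact ⟨W, _, _, ‹_›, e, HilbertBasis.mkOfOrthogonalEqBot hon hsp, he, fun i => by
    rw [HilbertBasis.coe_mkOfOrthogonalEqBot]⟩

/-- `H^1_0(Ω) = Ḣ^1`, through the energy basis of `H^1_0(Ω)`. -/
lemma IsEigenbasis.normEquiv_one (h : IsEigenbasis A hA μ ψ)
    (hs : ∀ u v : H10 Ω, A u v = A v u) :
    NormEquiv (imageNorm (H10.toHm1 Ω)) (dotNorm μ ψ 1) := by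
  obtain ⟨W, _, _, _, e, b, he, hb⟩ := h.exists_energy_basis hs
  set j : W →ₗ[ℝ] Hm1 Ω :=
    (H10.toHm1 Ω).comp e.symm.toLinearEquiv.toLinearMap with hj
  have key : ∀ F, imageNorm j F = dotNorm μ ψ 1 F := by
    refine imageNorm_eq_dotNorm b j h.pos (h.eq_zero hs) fun w i => ?_
    obtain ⟨u, rfl⟩ := e.surjective w
    have h1 : j (e u) = H10.toHm1 Ω u := by simp [hj]
    rw [h1, hb, inner_smul_left, he, toHm1_symm, map_smul, _root_.smul_apply, ← h.weak,
      smul_eq_mul]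
    simp only [conj_trivial]
  refine .intro (C := ‖(e.symm : W →L[ℝ] H10 Ω)‖₊ + 1) (D := ‖(e : H10 Ω →L[ℝ] W)‖₊ + 1)
    (fun F => ?_) fun F => ?_
  · rw [← key]
    exact imageNorm_le_of_forall (C := ‖(e.symm : W →L[ℝ] H10 Ω)‖₊)
      (fun w => ⟨e.symm w, rfl, (e.symm : W →L[ℝ] H10 Ω).le_opNorm w⟩) F
  · rw [← key]
    exact imageNorm_le_of_forall (C := ‖(e : H10 Ω →L[ℝ] W)‖₊)
      (fun u => ⟨e u, by simp [hj], (e : H10 Ω →L[ℝ] W).le_opNorm u⟩) F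

/-- `H^{-1}(Ω) = Ḣ^{-1}`, as `u ↦ A(u, ·)` is an isomorphism of `H^1_0(Ω)` with `H^{-1}(Ω)`. -/
lemma IsEigenbasis.normEquiv_neg_one (h : IsEigenbasis A hA μ ψ)
    (hs : ∀ u v : H10 Ω, A u v = A v u) :
    NormEquiv (imageNorm (LinearMap.id : Hm1 Ω →ₗ[ℝ] Hm1 Ω)) (dotNorm μ ψ (-1)) := by
  obtain ⟨W, _, _, _, e, b, he, hb⟩ := h.exists_energy_basis hs
  obtain ⟨g, hg⟩ : ∃ g : W →L[ℝ] Hm1 Ω, ∀ u, g (e u) = restrictForm A u :=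
    ⟨(restrictForm A).comp (e.symm : W →L[ℝ] H10 Ω), fun u => by
      rw [ContinuousLinearMap.comp_apply]
      exact congrArg _ (e.symm_apply_apply u)⟩
  have key : ∀ F, imageNorm g.toLinearMap F = dotNorm μ ψ (-1) F := by
    refine imageNorm_eq_dotNorm b _ h.pos (h.eq_zero hs) fun w i => ?_
    obtain ⟨u, rfl⟩ := e.surjective w
    change g (e u) _ = _
    rw [hg, hb, inner_smul_left, he, restrictForm_apply, map_smul, smul_eq_mul, hs, ← mul_assoc]
    simp only [conj_trivial]
    congr 1
    conv_rhs => rw [← Real.rpow_one (μ i), ← Real.rpow_mul (h.pos i).le, ← Real.rpow_add (h.pos i)]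
    norm_num
  obtain ⟨D, hD⟩ : ∃ D : ℝ≥0, ∀ F, ‖e (solutionOp A hA F)‖ ≤ D * ‖F‖ := by
    obtain ⟨C, hC⟩ := exists_norm_solutionOp_le (A := A) hA
    refine ⟨‖(e : H10 Ω →L[ℝ] W)‖₊ * C, fun F => ?_⟩
    calc ‖e (solutionOp A hA F)‖ ≤ ‖(e : H10 Ω →L[ℝ] W)‖ * ‖solutionOp A hA F‖ :=
          (e : H10 Ω →L[ℝ] W).le_opNorm _
      _ ≤ ‖(e : H10 Ω →L[ℝ] W)‖ * (C * ‖F‖) := by gcongr; exact hC F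
      _ = _ := by push_cast; ring
  refine .intro (C := ‖g‖₊ + 1) (D := D + 1) (fun F => ?_) fun F => ?_
  · rw [← key]
    exact imageNorm_le_of_forall (C := ‖g‖₊) (fun w => ⟨g w, rfl, g.le_opNorm w⟩) F
  · rw [← key]
    refine imageNorm_le_of_forall (fun G => ⟨e (solutionOp A hA G), ?_, hD G⟩) F
    change g (e _) = _
    rw [hg]
    ext φ
    exact apply_solutionOp G φ

/-- `L²(Ω) = Ḣ^0`, as the `ψ̃_i` are a Hilbert basis of `L²(Ω)`. -/
lemma IsEigenbasis.normEquiv_zero (h : IsEigenbasis A hA μ ψ)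
    (hs : ∀ u v : H10 Ω, A u v = A v u) (hd : DenseRange (H10.toL2 Ω)) :
    NormEquiv (imageNorm (L2.toHm1 Ω)) (dotNorm μ ψ 0) := by
  have hon : Orthonormal ℝ fun i => H10.toL2 Ω ((μ i) ^ (1 / 2 : ℝ) • ψ i) := by
    rw [orthonormal_iff_ite]
    exact h.toHm1_apply
  have hsp : (Submodule.span ℝ
      (range fun i => H10.toL2 Ω ((μ i) ^ (1 / 2 : ℝ) • ψ i)))ᗮ = ⊥ := by
    rw [Submodule.eq_bot_iff]
    intro f hf
    have h1 : L2.toHm1 Ω f = 0 := by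
      refine h.eq_zero hs _ fun i => ?_
      have h2 : inner ℝ f (H10.toL2 Ω ((μ i) ^ (1 / 2 : ℝ) • ψ i)) = 0 :=
        (Submodule.mem_orthogonal' _ _).1 hf _ (Submodule.subset_span ⟨i, rfl⟩)
      rw [map_smul, inner_smul_right] at h2
      exact (mul_eq_zero.1 h2).resolve_left (Real.rpow_pos_of_pos (h.pos i) _).ne'
    exact hd.eq_zero_of_inner_left ℝ fun u => DFunLike.congr_fun h1 u
  set b := HilbertBasis.mkOfOrthogonalEqBot hon hsp
  have key : ∀ F, imageNorm (L2.toHm1 Ω) F = dotNorm μ ψ 0 F := by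
    refine imageNorm_eq_dotNorm b _ h.pos (h.eq_zero hs) fun f i => ?_
    rw [HilbertBasis.coe_mkOfOrthogonalEqBot, zero_div, Real.rpow_zero, one_mul,
      real_inner_comm]
    rfl
  exact ⟨1, fun F => by simp [key]⟩

end

/-! ### Eigenfunctions of compact injections -/

/-- A positive family with finitely many members above any positive level can be enumerated in
non-increasing order. -/
lemma exists_bijective_antitone {I : Type*} [Infinite I] (m : I → ℝ) (hpos : ∀ i, 0 < m i)
    (hfin : ∀ ε > 0, {i | ε ≤ m i}.Finite) :
    ∃ f : ℕ → I, Function.Bijective f ∧ Antitone (m ∘ f) ∧ Tendsto (m ∘ f) atTop (𝓝 0) := by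
  classical
  have hpick : ∀ S : Finset I, ∃ i, i ∉ S ∧ ∀ k, k ∉ S → m k ≤ m i := by
    intro S
    obtain ⟨i₀, hi₀⟩ := Infinite.exists_notMem_finset S
    obtain ⟨i, hi, hmax⟩ := Set.exists_max_image ({i | m i₀ ≤ m i} \ S) m
      ((hfin _ (hpos i₀)).subset sdiff_subset) ⟨i₀, le_refl (m i₀), hi₀⟩
    refine ⟨i, hi.2, fun k hk => ?_⟩
    by_cases h : m i₀ ≤ m k
    · exact hmax k ⟨h, hk⟩
    · exact (not_le.1 h).le.trans hi.1
  choose pick hpick hmax using hpick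
  -- Enumerate greedily: `S n` collects the first `n` members.
  let S : ℕ → Finset I := fun n => Nat.rec ∅ (fun _ T => insert (pick T) T) n
  have hS : ∀ n, S (n + 1) = insert (pick (S n)) (S n) := fun n => rfl
  have hSmono : Monotone S := monotone_nat_of_le_succ fun n => by
    rw [hS]; exact Finset.subset_insert _ _
  have hmem : ∀ k n, k < n → pick (S k) ∈ S n := fun k n h =>
    hSmono (Nat.succ_le_of_lt h) (by rw [hS]; exact Finset.mem_insert_self _ _)
  have hinj : Function.Injective fun n => pick (S n) := by
    intro k n hkn
    have hkn : pick (S k) = pick (S n) := hkn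
    by_contra hne
    rcases lt_or_gt_of_ne hne with h | h
    · exact hpick (S n) (by rw [← hkn]; exact hmem k n h)
    · exact hpick (S k) (by rw [hkn]; exact hmem n k h)
  have hanti : Antitone fun n => m (pick (S n)) := by
    intro k n hkn
    exact hmax (S k) _ fun h => hpick (S n) (hSmono hkn h)
  have htend : Tendsto m cofinite (𝓝 0) := by
    refine tendsto_order.2 ⟨fun a ha => Eventually.of_forall fun i => ha.trans (hpos i),
      fun a ha => ?_⟩
    rw [eventually_cofinite]
    simpa using hfin a ha
  have htend' : Tendsto (fun n => m (pick (S n))) atTop (𝓝 0) := by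
    rw [← Nat.cofinite_eq_atTop]
    exact htend.comp hinj.tendsto_cofinite
  refine ⟨fun n => pick (S n), ⟨hinj, fun i => ?_⟩, hanti, htend'⟩
  by_contra! hi
  have hiS : ∀ n, i ∉ S n := by
    intro n
    induction n with
    | zero => exact Finset.notMem_empty i
    | succ n ih =>
      rw [hS, Finset.mem_insert, not_or]
      exact ⟨fun h => hi n h.symm, ih⟩
  obtain ⟨n, hn⟩ := (htend'.eventually (gt_mem_nhds (hpos i))).exists
  exact absurd (hmax (S n) i (hiS n)) (not_le.2 hn)

section

variable {W H : Type*} [NormedAddCommGroup W] [InnerProductSpace ℝ W] [NormedAddCommGroup H]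
  [InnerProductSpace ℝ H]

/-- A compact operator cannot map an infinite orthonormal family to an orthogonal family with norms
bounded from below. -/
lemma finite_of_isCompactOperator {I : Type*} {K : W →L[ℝ] H} (hK : IsCompactOperator K)
    {v : I → W} (hv : Orthonormal ℝ v) (ho : ∀ i j, i ≠ j → inner ℝ (K (v i)) (K (v j)) = 0)
    {ε : ℝ} (hε : 0 < ε) : {i | ε ≤ ‖K (v i)‖ ^ 2}.Finite := by
  by_contra hinf
  have hinf : {i | ε ≤ ‖K (v i)‖ ^ 2}.Infinite := hinf
  set f := hinf.natEmbedding
  have hcomp := hK.isCompact_closure_image_closedBall (𝕜₁ := ℝ) (𝕜₂ := ℝ)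
    (f := K.toLinearMap) 1
  obtain ⟨y, -, φ, hφ, hlim⟩ := hcomp.tendsto_subseq (x := fun n => K (v (f n))) fun n =>
    subset_closure ⟨v (f n), by simp [hv.1], rfl⟩
  have hc := hlim.cauchySeq
  rw [Metric.cauchySeq_iff'] at hc
  obtain ⟨N, hN⟩ := hc (Real.sqrt ε) (Real.sqrt_pos.2 hε)
  have h1 := hN (N + 1) (Nat.le_succ N)
  have hne : (f (φ (N + 1)) : I) ≠ f (φ N) := fun h =>
    (Nat.succ_ne_self N) (hφ.injective (f.injective (Subtype.ext h)))
  rw [dist_eq_norm, Real.lt_sqrt (norm_nonneg _)] at h1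
  simp only [Function.comp_apply] at h1
  rw [@norm_sub_sq_real, ho _ _ hne] at h1
  have h2 : ε ≤ ‖K (v (f (φ N)))‖ ^ 2 := (f (φ N)).2
  nlinarith [sq_nonneg ‖K (v (f (φ (N + 1))))‖]

variable [CompleteSpace W] [CompleteSpace H]

/-- The spectral theorem for `K* K`, where `K` is a compact injection of an infinite dimensional
Hilbert space: there is a Hilbert basis of eigenvectors, in the order of decreasing eigenvalues. -/
lemma exists_hilbertBasis_of_isCompactOperator (hW : ¬ FiniteDimensional ℝ W) (K : W →L[ℝ] H)
    (hK : IsCompactOperator K) (hinj : Function.Injective K) :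
    ∃ (b : HilbertBasis ℕ ℝ W) (μ : ℕ → ℝ), (∀ i, 0 < μ i) ∧ Antitone μ ∧
      Tendsto μ atTop (𝓝 0) ∧ ∀ i v, inner ℝ (K (b i)) (K v) = μ i * inner ℝ (b i) v := by
  set S : W →L[ℝ] W := K.adjoint.comp K with hS
  have hSin : ∀ u v, inner ℝ (S u) v = inner ℝ (K u) (K v) := fun u v => by
    rw [hS, ContinuousLinearMap.comp_apply, ContinuousLinearMap.adjoint_inner_left]
  have hSc : IsCompactOperator S := hK.clm_comp K.adjoint
  have hSs : (S : W →ₗ[ℝ] W).IsSymmetric := fun u v => by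
    change inner ℝ (S u) v = inner ℝ u (S v)
    rw [hSin, real_inner_comm, ← hSin, real_inner_comm]
  have hfd : ∀ m, FiniteDimensional ℝ (Module.End.eigenspace (S : W →ₗ[ℝ] W) m) := by
    intro m
    rcases eq_or_ne m 0 with rfl | hm
    · have : Module.End.eigenspace (S : W →ₗ[ℝ] W) 0 = ⊥ := by
        rw [Submodule.eq_bot_iff]
        intro u hu
        rw [Module.End.mem_eigenspace_iff, zero_smul] at hu
        have h1 : inner ℝ (S u) u = 0 := by
          rw [show S u = 0 from hu, inner_zero_left]
        rw [hSin, inner_self_eq_zero] at h1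
        exact hinj (h1.trans (map_zero K).symm)
      rw [this]
      infer_instance
    · exact ContinuousLinearMap.finite_dimensional_eigenspace hSc m hm
  let v : (Σ m : ℝ, Fin (Module.finrank ℝ (Module.End.eigenspace (S : W →ₗ[ℝ] W) m))) → W :=
    fun a => stdOrthonormalBasis ℝ (Module.End.eigenspace (S : W →ₗ[ℝ] W) a.1) a.2
  have hvo : Orthonormal ℝ v := hSs.orthogonalFamily_eigenspaces.orthonormal_sigma_orthonormal
    fun m => (stdOrthonormalBasis ℝ (Module.End.eigenspace (S : W →ₗ[ℝ] W) m)).orthonormal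
  have hvS : ∀ a, S (v a) = a.1 • v a := fun a =>
    Module.End.mem_eigenspace_iff.1
      (stdOrthonormalBasis ℝ (Module.End.eigenspace (S : W →ₗ[ℝ] W) a.1) a.2).2
  have hvK : ∀ a w, inner ℝ (K (v a)) (K w) = a.1 * inner ℝ (v a) w := fun a w => by
    rw [← hSin, hvS, real_inner_smul_left]
  have hvsp : (Submodule.span ℝ (range v))ᗮ = ⊥ := by
    rw [← le_bot_iff,
      ← ContinuousLinearMap.orthogonalComplement_iSup_eigenspaces_eq_bot hSc hSs]
    refine Submodule.orthogonal_le (iSup_le fun m => ?_)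
    intro u hu
    have h1 := (stdOrthonormalBasis ℝ (Module.End.eigenspace (S : W →ₗ[ℝ] W) m)).sum_repr ⟨u, hu⟩
    rw [← show ((⟨u, hu⟩ : Module.End.eigenspace (S : W →ₗ[ℝ] W) m) : W) = u from rfl, ← h1,
      Submodule.coe_sum]
    exact Submodule.sum_mem _ fun i _ => Submodule.smul_mem _ _
      (Submodule.subset_span ⟨⟨m, i⟩, rfl⟩)
  have hnorm : ∀ a, ‖K (v a)‖ ^ 2 = a.1 := fun a => by
    rw [← real_inner_self_eq_norm_sq, hvK, real_inner_self_eq_norm_sq, hvo.1]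
    simp
  have hpos : ∀ a, 0 < (Sigma.fst a : ℝ) := fun a => by
    rw [← hnorm a]
    have : K (v a) ≠ 0 := fun h => hvo.ne_zero a (hinj (h.trans (map_zero K).symm))
    positivity
  have hfin : ∀ ε > 0, {a : Σ m : ℝ,
      Fin (Module.finrank ℝ (Module.End.eigenspace (S : W →ₗ[ℝ] W) m)) | ε ≤ a.1}.Finite := by
    intro ε hε
    have := finite_of_isCompactOperator hK hvo (fun a a' h => by
      rw [hvK, hvo.2 h, mul_zero]) hε
    simpa only [hnorm] using this
  have hI : Infinite (Σ m : ℝ,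
      Fin (Module.finrank ℝ (Module.End.eigenspace (S : W →ₗ[ℝ] W) m))) := by
    by_contra hI
    rw [not_infinite_iff_finite] at hI
    have := Fintype.ofFinite (Σ m : ℝ,
      Fin (Module.finrank ℝ (Module.End.eigenspace (S : W →ₗ[ℝ] W) m)))
    exact hW (HilbertBasis.mkOfOrthogonalEqBot hvo
      hvsp).toOrthonormalBasis.toBasis.finiteDimensional_of_finite
  obtain ⟨f, hf, hanti, htend⟩ := exists_bijective_antitone _ hpos hfin
  have hrange : range (v ∘ f) = range v := hf.2.range_comp v
  refine ⟨HilbertBasis.mkOfOrthogonalEqBot (hvo.comp f hf.1) (by rw [hrange, hvsp]),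
    Sigma.fst ∘ f, fun i => hpos _, hanti, htend, fun i w => ?_⟩
  rw [HilbertBasis.coe_mkOfOrthogonalEqBot]
  exact hvK _ _

end

/-! ### Uniqueness of weak derivatives and existence of the eigenfunctions -/

section

variable {d : ℕ} {Ω : Set (E d)}

/-- A weak derivative is determined by the function. -/
lemma toL2_injective (hopen : IsOpen Ω) (k : ℕ) : Function.Injective (Sobolev.toL2 Ω k) := by
  refine (injective_iff_map_eq_zero _).2 fun v hv => ?_
  have hv0 : (v : PiLp 2 (fun _ : DerivIndex d k => L2 Ω)) (DerivIndex.zero d k) = 0 := hv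
  refine Subtype.ext (PiLp.ext fun i => ?_)
  have hloc : LocallyIntegrable ((v : PiLp 2 (fun _ : DerivIndex d k => L2 Ω)) i)
      (volume.restrict Ω) := (Lp.memLp _).locallyIntegrable (by norm_num)
  have hae := hopen.ae_eq_zero_of_integral_contDiff_smul_eq_zero (hloc.locallyIntegrableOn Ω)
    fun φ h1 h2 h3 => ?_
  · refine Lp.ext ?_
    filter_upwards [hae, ae_restrict_mem hopen.measurableSet,
      Lp.coeFn_zero ℝ 2 (volume.restrict Ω)] with x hx hxΩ h0
    rw [hx hxΩ]
    exact h0.symm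
  · have hφ : IsTest Ω φ := ⟨h1, h2, h3⟩
    have h4 := v.2 i φ hφ
    obtain ⟨G, hG⟩ := exists_integral_eq_inner Ω (continuous_partialDeriv hφ i.2)
      (hasCompactSupport_partialDeriv hφ i.2)
    rw [hv0, hG, inner_zero_right] at h4
    have h5 := (mul_eq_zero.1 h4.symm).resolve_left (pow_ne_zero _ (by norm_num))
    simpa only [smul_eq_mul, mul_comm] using h5

lemma H10_toL2_injective (hopen : IsOpen Ω) : Function.Injective (H10.toL2 Ω) :=
  (toL2_injective hopen 1).comp Subtype.val_injective

lemma L2_toHm1_injective (hd : DenseRange (H10.toL2 Ω)) : Function.Injective (L2.toHm1 Ω) := by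
  refine (injective_iff_map_eq_zero _).2 fun f hf => ?_
  exact hd.eq_zero_of_inner_left ℝ fun u => DFunLike.congr_fun hf u

lemma H10_toHm1_injective (hopen : IsOpen Ω) (hd : DenseRange (H10.toL2 Ω)) :
    Function.Injective (H10.toHm1 Ω) :=
  (L2_toHm1_injective hd).comp (H10_toL2_injective hopen)

/-- The indicator functions of infinitely many disjoint open sets are independent. For `d = 0` the
space is one-dimensional. -/
lemma not_finiteDimensional_L2 (hd : 1 ≤ d) (hΩ : Ω.Nonempty) (hopen : IsOpen Ω)
    (hbdd : Bornology.IsBounded Ω) : ¬ FiniteDimensional ℝ (L2 Ω) := by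
  have : Nonempty (Fin d) := ⟨⟨0, hd⟩⟩
  obtain ⟨x, hx⟩ := hΩ
  have hinf : Infinite Ω := (infinite_of_mem_nhds x (hopen.mem_nhds hx)).to_subtype
  obtain ⟨U, hUinf, hUo, hUd⟩ := exists_seq_infinite_isOpen_pairwise_disjoint Ω
  set O : ℕ → Set (E d) := fun n => Subtype.val '' U n
  have hO : ∀ n, IsOpen (O n) := fun n => hopen.isOpenMap_subtype_val _ (hUo n)
  have hsub : ∀ n, O n ⊆ Ω := fun n => Subtype.coe_image_subset _ _
  have hvol : volume.restrict Ω univ ≠ ⊤ := by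
    rw [Measure.restrict_apply_univ]
    exact hbdd.measure_lt_top.ne
  have hfin : ∀ n, volume.restrict Ω (O n) ≠ ⊤ := fun n =>
    ne_top_of_le_ne_top hvol (measure_mono (subset_univ _))
  have hposm : ∀ n, 0 < (volume.restrict Ω).real (O n) := fun n => by
    refine ENNReal.toReal_pos ?_ (hfin n)
    rw [Measure.restrict_eq_self _ (hsub n)]
    exact ((hO n).measure_pos volume ((hUinf n).nonempty.image _)).ne'
  set f : ℕ → L2 Ω := fun n => indicatorConstLp 2 (hO n).measurableSet (hfin n) (1 : ℝ)
  have hin : ∀ k n, inner ℝ (f k) (f n) = (volume.restrict Ω).real (O k ∩ O n) := fun k n =>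
    L2.real_inner_indicatorConstLp_one_indicatorConstLp_one _ _ (hfin k) (hfin n)
  have hli : LinearIndependent ℝ f := by
    refine linearIndependent_of_ne_zero_of_inner_eq_zero (fun n h => ?_) fun k n hkn => ?_
    · have := hin n n
      rw [h, inner_zero_left, inter_self] at this
      exact (hposm n).ne this
    · change inner ℝ (f k) (f n) = 0
      rw [hin, (disjoint_image_iff Subtype.val_injective |>.2 (hUd hkn)).inter_eq]
      simp
  intro hfd
  exact Infinite.not_finite (α := ℕ) hli.finite

/-- Otherwise the dense range of `H^1_0(Ω)` in `L²(Ω)` would be closed. -/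
lemma not_finiteDimensional_H10 (hd : 1 ≤ d) (hΩ : Ω.Nonempty) (hopen : IsOpen Ω)
    (hbdd : Bornology.IsBounded Ω) (hdense : DenseRange (H10.toL2 Ω)) :
    ¬ FiniteDimensional ℝ (H10 Ω) := by
  intro hfd
  have hfr := LinearMap.finiteDimensional_range (H10.toL2 Ω).toLinearMap
  have hcl : IsClosed (LinearMap.range (H10.toL2 Ω).toLinearMap : Set (L2 Ω)) :=
    Submodule.closed_of_finiteDimensional _
  have htop : LinearMap.range (H10.toL2 Ω).toLinearMap = ⊤ := by
    refine SetLike.coe_injective ?_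
    rw [← hcl.closure_eq]
    exact hdense.closure_eq
  rw [htop] at hfr
  exact not_finiteDimensional_L2 hd hΩ hopen hbdd
    (Submodule.topEquiv (R := ℝ) (M := L2 Ω)).finiteDimensional

variable {A : Sobolev Ω 1 →L[ℝ] H10 Ω →L[ℝ] ℝ}

lemma toHm1_smul_apply (c : ℝ) (u v : H10 Ω) :
    H10.toHm1 Ω (c • u) v = c * inner ℝ (H10.toL2 Ω u) (H10.toL2 Ω v) := by
  rw [toHm1_apply_eq_inner, map_smul, real_inner_smul_left]

set_option maxHeartbeats 1000000 in
/-- The eigenfunctions, normalized in the energy inner product. -/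
lemma exists_energy_eigenbasis (hA : IsCoercive (restrictForm A)) (hd : 1 ≤ d)
    (hΩ : Ω.Nonempty) (hopen : IsOpen Ω) (hbdd : Bornology.IsBounded Ω) (hs : ∀ u v : H10 Ω, A u v = A v u) (ha : ConditionA Ω) :
    ∃ (W : Type) (_ : NormedAddCommGroup W) (_ : InnerProductSpace ℝ W) (_ : CompleteSpace W)
      (e : H10 Ω ≃L[ℝ] W) (b : HilbertBasis ℕ ℝ W) (μ : ℕ → ℝ) (u : ℕ → H10 Ω),
      (∀ i, 0 < μ i) ∧ Antitone μ ∧ Tendsto μ atTop (𝓝 0) ∧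
      (∀ v w, inner ℝ (e v) (e w) = restrictForm A v w) ∧ (∀ i, e (u i) = b i) ∧
      ∀ i φ, inner ℝ (H10.toL2 Ω (u i)) (H10.toL2 Ω φ) = μ i * A (u i) φ := by
  obtain ⟨W, _, _, _, e, he⟩ := exists_energySpace (V := H10 Ω) (restrictForm A) hs hA
  have hinf : ¬ FiniteDimensional ℝ W := fun hW =>
    not_finiteDimensional_H10 hd hΩ hopen hbdd ha.2 e.symm.toLinearEquiv.finiteDimensional
  obtain ⟨K, hK⟩ : ∃ K : W →L[ℝ] L2 Ω, K = (H10.toL2 Ω).comp (e.symm : W →L[ℝ] H10 Ω) := ⟨_, rfl⟩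
  have hKe : ∀ u, K (e u) = H10.toL2 Ω u := fun u => by
    rw [hK]
    exact congrArg (H10.toL2 Ω) (e.symm_apply_apply u)
  have hKc : IsCompactOperator K := by
    rw [hK]
    exact ha.1.comp_clm (e.symm : W →L[ℝ] H10 Ω)
  have hKi : Function.Injective K := by
    rw [hK]
    exact (H10_toL2_injective hopen).comp e.symm.injective
  obtain ⟨b, μ, hpos, hanti, htend, hb⟩ := exists_hilbertBasis_of_isCompactOperator hinf K hKc hKi
  obtain ⟨u, hu⟩ : ∃ u : ℕ → H10 Ω, ∀ i, e (u i) = b i :=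
    ⟨fun i => e.symm (b i), fun i => e.apply_symm_apply _⟩
  refine ⟨W, _, _, ‹_›, e, b, μ, u, hpos, hanti, htend, he, hu, fun i φ => ?_⟩
  rw [← hKe, ← hKe, hu, hb, ← hu, he, restrictForm_apply]

lemma exists_isEigenbasis (hA : IsCoercive (restrictForm A)) (hd : 1 ≤ d)
    (hΩ : Ω.Nonempty) (hopen : IsOpen Ω) (hbdd : Bornology.IsBounded Ω) (hs : ∀ u v : H10 Ω, A u v = A v u) (ha : ConditionA Ω) :
    ∃ (μ : ℕ → ℝ) (ψ : ℕ → H10 Ω), IsEigenbasis A hA μ ψ := by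
  obtain ⟨W, _, _, _, e, b, μ, u, hpos, hanti, htend, he, hu, hweak⟩ :=
    exists_energy_eigenbasis hA hd hΩ hopen hbdd hs ha
  have hψ : ∀ i φ, H10.toHm1 Ω ((μ i)⁻¹ • u i) φ = A (u i) φ := by
    intro i φ
    rw [toHm1_smul_apply, hweak, inv_mul_cancel_left₀ (hpos i).ne']
  have heig : ∀ i, solutionOp A hA (H10.toHm1 Ω ((μ i)⁻¹ • u i)) = u i := by
    intro i
    rw [solutionOp_eq_iff]
    exact fun φ => (hψ i φ).symm
  obtain ⟨g, hg⟩ : ∃ g : W →L[ℝ] Hm1 Ω, ∀ v, g (e v) = restrictForm A v :=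
    ⟨(restrictForm A).comp (e.symm : W →L[ℝ] H10 Ω), fun v =>
      congrArg (restrictForm A) (e.symm_apply_apply v)⟩
  have hgs : Function.Surjective g := fun F => ⟨e (solutionOp A hA F), by
    rw [hg]
    ext φ
    exact apply_solutionOp F φ⟩
  refine ⟨μ, fun i => (μ i)⁻¹ • u i, hpos, hanti, htend, fun i => ?_, fun i j => ?_, ?_⟩
  · rw [heig, smul_inv_smul₀ (hpos i).ne']
  · rw [heig, hψ, ← restrictForm_apply, ← he, hu, hu]
    exact orthonormal_iff_ite.1 b.orthonormal i j
  · -- The map `u ↦ A u` takes the dense span of the eigenvectors in `H^1_0` onto this span.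
    have h1 := hgs.denseRange.topologicalClosure_map_submodule b.dense_span
    rw [Submodule.map_span, ← range_comp] at h1
    rw [← h1]
    congr 3
    ext1 i
    ext φ
    rw [hψ, Function.comp_apply, ← hu]
    exact (DFunLike.congr_fun (hg (u i)) φ).symm

end

/-! ### The equivalence of the two scales -/

/-- Enlarging the constant makes it positive, so that the bound is trivial if `y = ∞`. -/
lemma le_mul_of_lt_top_imp {x y : ℝ≥0∞} {C : ℝ≥0} (h : y < ⊤ → x ≤ C * y) :
    x ≤ (C + 1 : ℝ≥0) * y := by
  rcases eq_or_ne y ⊤ with rfl | hy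
  · rw [ENNReal.mul_top (by simp)]
    exact le_top
  · refine (h hy.lt_top).trans ?_
    gcongr
    simp

section

variable {d : ℕ} {Ω : Set (E d)} {μ : ℕ → ℝ} {ψ : ℕ → H10 Ω}

lemma NormEquiv.coincide {s : ℝ} (h : NormEquiv (tildeNorm Ω s) (dotNorm μ ψ s)) :
    CoincideWithEquivalentNorms μ ψ s := by
  obtain ⟨C, hC⟩ := h
  refine ⟨?_, (C + 1)⁻¹, C, by positivity, fun F _ => ⟨?_, (hC F).1⟩⟩
  · ext F
    exact ⟨fun hF => (hC F).2.trans_lt (ENNReal.mul_lt_top ENNReal.coe_lt_top hF),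
      fun hF => (hC F).1.trans_lt (ENNReal.mul_lt_top ENNReal.coe_lt_top hF)⟩
  · rw [ENNReal.coe_inv (by positivity), ENNReal.inv_mul_le_iff (by simp) ENNReal.coe_ne_top]
    refine (hC F).2.trans ?_
    gcongr
    simp

lemma HsNorm_one_add (α : ℝ) (u : L2 Ω) : HsNorm Ω (1 + α) u =
    interpNorm (Sobolev.toL2 Ω 1).toLinearMap (Sobolev.toL2 Ω 2).toLinearMap α u := by
  rw [HsNorm, add_sub_cancel_left]

lemma HsNorm_one (hopen : IsOpen Ω) (u : H10 Ω) : HsNorm Ω 1 (H10.toL2 Ω u) = ‖u‖ₑ := by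
  rw [HsNorm, sub_self, interpNorm, if_pos rfl]
  exact imageNorm_of_injective (j₀ := (Sobolev.toL2 Ω 1).toLinearMap) (toL2_injective hopen 1) u

/-- The infimum that defines `tildeNorm` is over a single `u`. -/
lemma tildeNorm_toHm1 (hopen : IsOpen Ω) (hd : DenseRange (H10.toL2 Ω)) {s : ℝ} (hs : 1 ≤ s)
    (u : H10 Ω) : tildeNorm Ω s (H10.toHm1 Ω u) = HsNorm Ω s (H10.toL2 Ω u) := by
  rw [tildeNorm, if_pos hs]
  refine le_antisymm (iInf₂_le_of_le u rfl le_rfl) (le_iInf₂ fun v hv => ?_)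
  rw [H10_toHm1_injective hopen hd hv]

lemma exists_of_tildeNorm_lt_top {s : ℝ} (hs : 1 ≤ s) {F : Hm1 Ω} (hF : tildeNorm Ω s F < ⊤) :
    ∃ u, H10.toHm1 Ω u = F := by
  rw [tildeNorm, if_pos hs] at hF
  simp only [iInf_lt_iff] at hF
  obtain ⟨u, hu, -⟩ := hF
  exact ⟨u, hu⟩

variable {A : Sobolev Ω 1 →L[ℝ] H10 Ω →L[ℝ] ℝ} {hA : IsCoercive (restrictForm A)}

/-- The equivalence for `-1 ≤ s ≤ 1`, by interpolation between `-1`, `0` and `1`. -/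
lemma IsEigenbasis.normEquiv_tildeNorm (h : IsEigenbasis A hA μ ψ) (hopen : IsOpen Ω)
    (hs : ∀ u v : H10 Ω, A u v = A v u) (hd : DenseRange (H10.toL2 Ω)) {s : ℝ}
    (hs1 : -1 ≤ s) (hs2 : s ≤ 1) : NormEquiv (tildeNorm Ω s) (dotNorm μ ψ s) := by
  rcases hs2.eq_or_lt with rfl | hs2
  · have : tildeNorm Ω 1 = imageNorm (H10.toHm1 Ω) := by
      ext F
      rw [tildeNorm, if_pos le_rfl, imageNorm]
      simp only [HsNorm_one hopen]
    rw [this]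
    exact h.normEquiv_one hs
  rcases lt_or_ge s 0 with h0 | h0
  · have ht : tildeNorm Ω s =
        interpNorm (LinearMap.id : Hm1 Ω →ₗ[ℝ] Hm1 Ω) (L2.toHm1 Ω) (1 + s) := by
      ext F
      rw [tildeNorm, if_neg (not_le.2 hs2), if_neg (not_le.2 h0)]
    rw [ht]
    rcases hs1.eq_or_lt with rfl | hs1
    · have : interpNorm (LinearMap.id : Hm1 Ω →ₗ[ℝ] Hm1 Ω) (L2.toHm1 Ω) (1 + -1) =
          imageNorm (LinearMap.id : Hm1 Ω →ₗ[ℝ] Hm1 Ω) := by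
        ext F
        rw [interpNorm, if_pos (by norm_num)]
      rw [this]
      exact h.normEquiv_neg_one hs
    · have := h.normEquiv_interpNorm (p := -1) (θ := 1 + s) (h.normEquiv_neg_one hs)
        (by rw [neg_add_cancel]; exact h.normEquiv_zero hs hd) (by linarith) (by linarith)
      rwa [neg_add_cancel_left] at this
  · have ht : tildeNorm Ω s = interpNorm (L2.toHm1 Ω) (H10.toHm1 Ω) s := by
      ext F
      rw [tildeNorm, if_neg (not_le.2 hs2), if_pos h0]
    rw [ht]
    rcases h0.eq_or_lt with rfl | h0
    · have : interpNorm (L2.toHm1 Ω) (H10.toHm1 Ω) 0 = imageNorm (L2.toHm1 Ω) := by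
        ext F
        rw [interpNorm, if_pos rfl]
      rw [this]
      exact h.normEquiv_zero hs hd
    · have := h.normEquiv_interpNorm (p := 0) (θ := s) (h.normEquiv_zero hs hd)
        (by rw [zero_add]; exact h.normEquiv_one hs) h0 hs2
      rwa [zero_add] at this

/-- The operator `L` shifts the spectral scale by `2`. -/
lemma IsEigenbasis.dotNorm_apply (h : IsEigenbasis A hA μ ψ)
    (hs : ∀ u v : H10 Ω, A u v = A v u) (s : ℝ) (u : H10 Ω) :
    dotNorm μ ψ s (A u) = dotNorm μ ψ (s + 2) (H10.toHm1 Ω u) := by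
  rw [dotNorm, dotNorm]
  congr 2
  ext i
  have hm := h.pos i
  have h1 : H10.toHm1 Ω u (ψ i) = μ i * A u (ψ i) := by rw [toHm1_symm, ← h.weak, hs]
  rw [map_smul, map_smul, h1, smul_eq_mul, smul_eq_mul, neg_add, Real.rpow_add hm,
    Real.rpow_neg hm.le 2, Real.rpow_two]
  congr 1
  field_simp

/-- `Ḣ^{s'} ⊆ Ḣ^s` for `s ≤ s'`, as the eigenvalues are bounded. -/
lemma IsEigenbasis.dotNorm_lt_top (h : IsEigenbasis A hA μ ψ) {s s' : ℝ} (hss : s ≤ s')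
    {F : Hm1 Ω} (hF : dotNorm μ ψ s' F < ⊤) : dotNorm μ ψ s F < ⊤ := by
  have h1 : dotNorm μ ψ s F ^ 2 ≤ ENNReal.ofReal ((μ 0) ^ (s' - s)) * dotNorm μ ψ s' F ^ 2 := by
    rw [dotNorm_sq, dotNorm_sq, ← ENNReal.tsum_mul_left]
    refine ENNReal.tsum_le_tsum fun i => ?_
    rw [← ENNReal.ofReal_mul (Real.rpow_nonneg (h.pos 0).le _), ← mul_assoc]
    refine ENNReal.ofReal_le_ofReal (mul_le_mul_of_nonneg_right ?_ (sq_nonneg _))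
    calc (μ i) ^ (-s) = (μ i) ^ (s' - s) * (μ i) ^ (-s') := by
          rw [← Real.rpow_add (h.pos i)]; congr 1; ring
      _ ≤ _ := mul_le_mul_of_nonneg_right (Real.rpow_le_rpow (h.pos i).le
          (h.antitone (Nat.zero_le i)) (sub_nonneg.2 hss)) (Real.rpow_nonneg (h.pos i).le _)
  have h2 : dotNorm μ ψ s F ^ 2 < ⊤ :=
    h1.trans_lt (ENNReal.mul_lt_top ENNReal.ofReal_lt_top (ENNReal.pow_lt_top hF))
  rw [lt_top_iff_ne_top] at h2 ⊢
  intro h3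
  exact h2 (by rw [h3]; rfl)

lemma IsEigenbasis.exists_of_dotNorm_lt_top (h : IsEigenbasis A hA μ ψ)
    (hs : ∀ u v : H10 Ω, A u v = A v u) {s : ℝ} (h1s : 1 ≤ s) {F : Hm1 Ω}
    (hF : dotNorm μ ψ s F < ⊤) : ∃ u, H10.toHm1 Ω u = F := by
  obtain ⟨C, hC⟩ := h.normEquiv_one hs
  exact exists_of_imageNorm_lt_top ((hC F).1.trans_lt
    (ENNReal.mul_lt_top ENNReal.coe_lt_top (h.dotNorm_lt_top h1s hF)))

/-- The equivalence for `s = 1 + α`: by (c) and (d), `T` and `L` are inverse isomorphisms between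
`H̃^{-1+α}` and `H̃^{1+α}`, as they are between `Ḣ^{-1+α}` and `Ḣ^{1+α}`. -/
lemma IsEigenbasis.normEquiv_tildeNorm_one_add (h : IsEigenbasis A hA μ ψ) (hopen : IsOpen Ω)
    (hs : ∀ u v : H10 Ω, A u v = A v u) (hd : DenseRange (H10.toL2 Ω)) {α : ℝ}
    (hα : 0 < α) (hα1 : α ≤ 1) (hc : ConditionC A hA α) (hD : ConditionD A α) :
    NormEquiv (tildeNorm Ω (1 + α)) (dotNorm μ ψ (1 + α)) := by
  obtain ⟨C, hC⟩ := h.normEquiv_tildeNorm hopen hs hd (s := -1 + α) (by linarith) (by linarith)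
  obtain ⟨Cc, hCc⟩ := hc
  obtain ⟨Cd, hCd⟩ := hD
  have h1α : 1 ≤ 1 + α := by linarith
  have hdot : ∀ u : H10 Ω, dotNorm μ ψ (1 + α) (H10.toHm1 Ω u) = dotNorm μ ψ (-1 + α) (A u) :=
    fun u => by
      rw [h.dotNorm_apply hs]
      congr 1
      ring
  refine NormEquiv.intro (C := Cc * C + 1) (D := C * Cd + 1)
    (fun F => le_mul_of_lt_top_imp fun hF => ?_) fun F => le_mul_of_lt_top_imp fun hF => ?_
  · obtain ⟨u, rfl⟩ := h.exists_of_dotNorm_lt_top hs h1α hF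
    rw [hdot] at hF ⊢
    have hTu : solutionOp A hA (A u) = u := (solutionOp_eq_iff A hA _ _).2 fun φ => rfl
    have h1 := hCc (A u) ((hC _).1.trans_lt (ENNReal.mul_lt_top ENNReal.coe_lt_top hF))
    rw [hTu] at h1
    refine h1.trans ?_
    rw [ENNReal.coe_mul, mul_assoc]
    gcongr
    exact (hC _).1
  · obtain ⟨u, rfl⟩ := exists_of_tildeNorm_lt_top h1α hF
    rw [tildeNorm_toHm1 hopen hd h1α] at hF ⊢
    rw [hdot, ENNReal.coe_mul, mul_assoc]
    refine (hC _).2.trans ?_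
    gcongr
    exact hCd u hF

/-- The K-functional of `H^1(Ω), H^2(Ω)` dominates the norm of `L²(Ω)`. -/
lemma KFunctional_toL2_ne_zero {t : ℝ} (ht : 0 < t) {v : L2 Ω} (hv : v ≠ 0) :
    KFunctional (Sobolev.toL2 Ω 1).toLinearMap (Sobolev.toL2 Ω 2).toLinearMap t v ≠ 0 := by
  have hle : ∀ k (w : Sobolev Ω k), ‖Sobolev.toL2 Ω k w‖ ≤ ‖w‖ := fun k w =>
    PiLp.norm_apply_le (w : PiLp 2 (fun _ : DerivIndex d k => L2 Ω)) (DerivIndex.zero d k)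
  have hpos : 0 < min 1 t * ‖v‖ := mul_pos (lt_min one_pos ht) (norm_pos_iff.2 hv)
  have key : ENNReal.ofReal (min 1 t * ‖v‖) ≤
      KFunctional (Sobolev.toL2 Ω 1).toLinearMap (Sobolev.toL2 Ω 2).toLinearMap t v := by
    refine le_iInf₂ fun a b => le_iInf fun hab => ?_
    rw [← ofReal_norm a, ← ofReal_norm b, ← ENNReal.ofReal_mul ht.le,
      ← ENNReal.ofReal_add (norm_nonneg _) (by positivity)]
    refine ENNReal.ofReal_le_ofReal ?_
    have h1 : ‖v‖ ≤ ‖a‖ + ‖b‖ := by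
      rw [← hab]
      exact (norm_add_le _ _).trans (add_le_add (hle 1 a) (hle 2 b))
    have hm : 0 ≤ min 1 t := (lt_min one_pos ht).le
    calc min 1 t * ‖v‖ ≤ min 1 t * (‖a‖ + ‖b‖) := by gcongr
      _ = min 1 t * ‖a‖ + min 1 t * ‖b‖ := mul_add _ _ _
      _ ≤ 1 * ‖a‖ + t * ‖b‖ := by
        gcongr
        · exact min_le_left _ _
        · exact min_le_right _ _
      _ = _ := by rw [one_mul]
  exact ((ENNReal.ofReal_pos.2 hpos).trans_le key).ne'

set_option maxHeartbeats 400000 in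
/-- `Ḣ^{1+σ} ⊆ H^{1+σ}(Ω)`: split along the eigenfunctions. -/
lemma IsEigenbasis.KFunctional_le_spectralK (h : IsEigenbasis A hA μ ψ) (hopen : IsOpen Ω)
    (hs : ∀ u v : H10 Ω, A u v = A v u) (hd : DenseRange (H10.toL2 Ω)) {α : ℝ}
    (hα : 0 < α) (hα1 : α ≤ 1) (he : NormEquiv (tildeNorm Ω (1 + α)) (dotNorm μ ψ (1 + α))) :
    ∃ C : ℝ≥0, ∀ t : ℝ, 0 < t → ∀ u : H10 Ω,
      KFunctional (Sobolev.toL2 Ω 1).toLinearMap (Sobolev.toL2 Ω 2).toLinearMap t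
        (H10.toL2 Ω u) ^ 2 ≤ C * spectralK μ ψ 1 α t (H10.toHm1 Ω u) := by
  obtain ⟨C₁, hC₁⟩ := h.normEquiv_one hs
  obtain ⟨C₂, hC₂⟩ := he
  obtain ⟨C₃, hC₃⟩ := exists_KFunctional_le_interpNorm (Sobolev.toL2 Ω 1).toLinearMap
    (Sobolev.toL2 Ω 2).toLinearMap hα hα1
  refine ⟨2 * (C₁ ^ 2 + C₃ * C₂ ^ 2) + 1, fun t ht u => le_mul_of_lt_top_imp fun hfin => ?_⟩
  obtain ⟨G, G', hGu, hG⟩ := h.exists_split (p := 1) hα ht (H10.toHm1 Ω u)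
  rw [← hG] at hfin ⊢
  have hG1 : dotNorm μ ψ 1 G < ⊤ := by
    have := (le_self_add.trans_lt hfin).ne
    rw [lt_top_iff_ne_top]
    intro h3
    exact this (by rw [h3]; rfl)
  obtain ⟨a, rfl⟩ := h.exists_of_dotNorm_lt_top hs le_rfl hG1
  obtain rfl : G' = H10.toHm1 Ω (u - a) := by
    rw [map_sub, ← hGu, add_sub_cancel_left]
  set K := KFunctional (Sobolev.toL2 Ω 1).toLinearMap (Sobolev.toL2 Ω 2).toLinearMap t
  have h1 : K (H10.toL2 Ω a) ^ 2 ≤ (C₁ ^ 2 : ℝ≥0) * dotNorm μ ψ 1 (H10.toHm1 Ω a) ^ 2 := by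
    refine sq_le_of_le ((KFunctional_left_le _ _ t (a : Sobolev Ω 1)).trans ?_)
    refine le_trans (le_of_eq ?_) (hC₁ _).1
    exact (imageNorm_of_injective (j₀ := H10.toHm1 Ω) (H10_toHm1_injective hopen hd) a).symm
  have h2 : K (H10.toL2 Ω (u - a)) ^ 2 ≤ C₃ * (ENNReal.ofReal (t ^ (2 * α)) *
      ((C₂ ^ 2 : ℝ≥0) * dotNorm μ ψ (1 + α) (H10.toHm1 Ω (u - a)) ^ 2)) := by
    refine (hC₃ t ht _).trans ?_
    gcongr
    rw [← HsNorm_one_add, ← tildeNorm_toHm1 hopen hd (by linarith)]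
    exact sq_le_of_le (hC₂ _).1
  have h3 : K (H10.toL2 Ω u) ≤ K (H10.toL2 Ω a) + K (H10.toL2 Ω (u - a)) := by
    have := KFunctional_add_le (Sobolev.toL2 Ω 1).toLinearMap (Sobolev.toL2 Ω 2).toLinearMap
      t (H10.toL2 Ω a) (H10.toL2 Ω (u - a))
    rwa [← map_add (H10.toL2 Ω), add_sub_cancel] at this
  generalize K (H10.toL2 Ω u) = k at h3 ⊢
  generalize K (H10.toL2 Ω a) = k₁ at h1 h3
  generalize K (H10.toL2 Ω (u - a)) = k₂ at h2 h3
  generalize dotNorm μ ψ 1 (H10.toHm1 Ω a) = n₁ at h1 ⊢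
  generalize dotNorm μ ψ (1 + α) (H10.toHm1 Ω (u - a)) = n₂ at h2 ⊢
  calc k ^ 2 ≤ 2 * (k₁ ^ 2 + k₂ ^ 2) := (pow_le_pow_left' h3 2).trans (ENNReal_add_sq_le _ _)
    _ ≤ 2 * ((C₁ ^ 2 : ℝ≥0) * n₁ ^ 2 + C₃ * (ENNReal.ofReal (t ^ (2 * α)) *
          ((C₂ ^ 2 : ℝ≥0) * n₂ ^ 2))) := by gcongr
    _ = 2 * ((C₁ ^ 2 : ℝ≥0) * n₁ ^ 2 +
          (C₃ * C₂ ^ 2 : ℝ≥0) * (ENNReal.ofReal (t ^ (2 * α)) * n₂ ^ 2)) := by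
        push_cast
        ring
    _ ≤ 2 * ((C₁ ^ 2 + C₃ * C₂ ^ 2 : ℝ≥0) * n₁ ^ 2 +
          (C₁ ^ 2 + C₃ * C₂ ^ 2 : ℝ≥0) * (ENNReal.ofReal (t ^ (2 * α)) * n₂ ^ 2)) := by
        gcongr <;> simp
    _ = _ := by
        push_cast
        ring

/-- The operator `L` is defined on all of `H^1(Ω)`, so that it can be applied to the parts of an
arbitrary splitting. -/
lemma IsEigenbasis.spectralK_apply_le (h : IsEigenbasis A hA μ ψ) (hopen : IsOpen Ω)
    (hs : ∀ u v : H10 Ω, A u v = A v u) (hd : DenseRange (H10.toL2 Ω)) {α : ℝ}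
    (hα : 0 < α) (hα1 : α ≤ 1) (hD : ConditionD A α) :
    ∃ C : ℝ≥0, ∀ t : ℝ, 0 < t → ∀ a w : Sobolev Ω 1,
      spectralK μ ψ (-1) α t (A a + A w) ≤ C * (‖a‖ₑ ^ 2 +
        ENNReal.ofReal (t ^ (2 * α)) * HsNorm Ω (1 + α) (Sobolev.toL2 Ω 1 w) ^ 2) := by
  obtain ⟨C₁, hC₁⟩ := h.normEquiv_neg_one hs
  obtain ⟨C₂, hC₂⟩ := h.normEquiv_tildeNorm hopen hs hd (s := -1 + α) (by linarith) (by linarith)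
  obtain ⟨Cd, hCd⟩ := hD
  obtain ⟨D, hDdef⟩ : ∃ D, D = (C₁ * ‖A‖₊) ^ 2 + (C₂ * (Cd + 1)) ^ 2 := ⟨_, rfl⟩
  refine ⟨2 * D, fun t ht a w => ?_⟩
  have h1 : dotNorm μ ψ (-1) (A a) ≤ (C₁ * ‖A‖₊ : ℝ≥0) * ‖a‖ₑ := by
    refine (hC₁ _).2.trans ?_
    rw [ENNReal.coe_mul, mul_assoc]
    gcongr
    refine (imageNorm_apply_le (LinearMap.id : Hm1 Ω →ₗ[ℝ] Hm1 Ω) (A a)).trans ?_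
    rw [enorm_eq_nnnorm, enorm_eq_nnnorm, ← ENNReal.coe_mul, ENNReal.coe_le_coe]
    exact A.le_opNNNorm a
  have h2 : dotNorm μ ψ (-1 + α) (A w) ≤
      (C₂ * (Cd + 1) : ℝ≥0) * HsNorm Ω (1 + α) (Sobolev.toL2 Ω 1 w) := by
    refine (hC₂ _).2.trans ?_
    rw [ENNReal.coe_mul, mul_assoc]
    gcongr
    exact le_mul_of_lt_top_imp fun hfin => hCd _ hfin
  have hle1 : (C₁ * ‖A‖₊) ^ 2 ≤ D := by rw [hDdef]; exact le_self_add
  have hle2 : (C₂ * (Cd + 1)) ^ 2 ≤ D := by rw [hDdef]; exact le_add_self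
  calc spectralK μ ψ (-1) α t (A a + A w)
      ≤ 2 * (dotNorm μ ψ (-1) (A a) ^ 2 +
          ENNReal.ofReal (t ^ (2 * α)) * dotNorm μ ψ (-1 + α) (A w) ^ 2) :=
        spectralK_le h.pos ht _ _
    _ ≤ 2 * (D * ‖a‖ₑ ^ 2 + ENNReal.ofReal (t ^ (2 * α)) *
          (D * HsNorm Ω (1 + α) (Sobolev.toL2 Ω 1 w) ^ 2)) := by
        gcongr
        · exact (sq_le_of_le h1).trans (by gcongr)
        · exact (sq_le_of_le h2).trans (by gcongr)
    _ = _ := by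
        rw [ENNReal.coe_mul, ENNReal.coe_ofNat]
        ring

/-- `H^{1+σ}(Ω) ∩ H^1_0(Ω) ⊆ Ḣ^{1+σ}`: apply `L` to the parts of an almost optimal splitting. -/
lemma IsEigenbasis.spectralK_le_kTail (h : IsEigenbasis A hA μ ψ) (hopen : IsOpen Ω)
    (hs : ∀ u v : H10 Ω, A u v = A v u) (hd : DenseRange (H10.toL2 Ω)) {α : ℝ}
    (hα : 0 < α) (hα1 : α ≤ 1) (hD : ConditionD A α) :
    ∃ C : ℝ≥0, ∀ t : ℝ, 0 < t → ∀ u : H10 Ω,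
      spectralK μ ψ (-1) α t (A u) ≤ C * (ENNReal.ofReal (t ^ (2 * α)) *
        kTail (Sobolev.toL2 Ω 1).toLinearMap (Sobolev.toL2 Ω 2).toLinearMap α t
          (H10.toL2 Ω u)) := by
  obtain ⟨D, hDD⟩ := h.spectralK_apply_le hopen hs hd hα hα1 hD
  obtain ⟨C, hC⟩ := exists_split_le_kTail (Sobolev.toL2 Ω 1).toLinearMap
    (Sobolev.toL2 Ω 2).toLinearMap hα hα1
  refine ⟨D * C, fun t ht u => ?_⟩
  rcases eq_or_ne u 0 with rfl | hu
  · have : spectralK μ ψ (-1) α t (A ((0 : H10 Ω) : Sobolev Ω 1)) = 0 := by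
      rw [Submodule.coe_zero, map_zero, spectralK]
      simp
    rw [this]
    exact zero_le
  have hu' : H10.toL2 Ω u ≠ 0 := fun h0 =>
    hu (H10_toL2_injective hopen (h0.trans (map_zero _).symm))
  have htop : KFunctional (Sobolev.toL2 Ω 1).toLinearMap (Sobolev.toL2 Ω 2).toLinearMap t
      (H10.toL2 Ω u) ≠ ⊤ :=
    ((KFunctional_left_le _ _ t (u : Sobolev Ω 1)).trans_lt enorm_lt_top).ne
  obtain ⟨a, b, hab, hle⟩ := hC t ht _ (KFunctional_toL2_ne_zero ht hu') htop
  -- The smoother part is in `H^1(Ω)`, as the difference of `u` and the other part.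
  obtain ⟨w, hw⟩ : ∃ w : Sobolev Ω 1, a + w = u := ⟨(u : Sobolev Ω 1) - a, add_sub_cancel _ _⟩
  have hb : (Sobolev.toL2 Ω 2).toLinearMap b = Sobolev.toL2 Ω 1 w := by
    refine add_left_cancel (a := Sobolev.toL2 Ω 1 a) ?_
    rw [← map_add (Sobolev.toL2 Ω 1), hw]
    exact hab
  rw [hb, ← HsNorm_one_add] at hle
  rw [← hw, map_add A]
  refine (hDD t ht a w).trans ?_
  rw [ENNReal.coe_mul, mul_assoc]
  gcongr

/-- The equivalence for `1 < s < 1 + α`, by interpolation between `1` and `1 + α`. -/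
lemma IsEigenbasis.normEquiv_tildeNorm_one_add_of_lt (h : IsEigenbasis A hA μ ψ)
    (hopen : IsOpen Ω) (hs : ∀ u v : H10 Ω, A u v = A v u) (hd : DenseRange (H10.toL2 Ω))
    {α σ : ℝ} (hσ : 0 < σ) (hσα : σ < α) (hα1 : α ≤ 1) (hc : ConditionC A hA α)
    (hD : ConditionD A α) : NormEquiv (tildeNorm Ω (1 + σ)) (dotNorm μ ψ (1 + σ)) := by
  have hα := hσ.trans hσα
  have hσ1 : σ < 1 := hσα.trans_le hα1
  have h1σ : 1 ≤ 1 + σ := by linarith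
  obtain ⟨C, hC⟩ := h.KFunctional_le_spectralK hopen hs hd hα hα1
    (h.normEquiv_tildeNorm_one_add hopen hs hd hα hα1 hc hD)
  obtain ⟨D, hDD⟩ := h.spectralK_le_kTail hopen hs hd hα hα1 hD
  have hκ : (0 : ℝ) < 1 / (2 * (α - σ)) + 1 / (2 * σ) := by
    have : 0 < α - σ := by linarith
    positivity
  have hint := fun p F => lintegral_spectralK (ψ := ψ) h.pos (p := p) hσ hσα F
  set κ : ℝ := 1 / (2 * (α - σ)) + 1 / (2 * σ)
  set κ' : ℝ := 1 / (2 * (α - σ)) with hκ'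
  have htilde : ∀ u : H10 Ω, tildeNorm Ω (1 + σ) (H10.toHm1 Ω u) ^ 2 =
      ∫⁻ t in Ioi (0 : ℝ), ENNReal.ofReal (t ^ (-(2 * σ) - 1)) *
        KFunctional (Sobolev.toL2 Ω 1).toLinearMap (Sobolev.toL2 Ω 2).toLinearMap t
          (H10.toL2 Ω u) ^ 2 := fun u => by
    rw [tildeNorm_toHm1 hopen hd h1σ, HsNorm_one_add, interpNorm_sq _ _ hσ hσ1]
  refine NormEquiv.intro (C := NNReal.sqrt (C * κ.toNNReal) + 1)
    (D := NNReal.sqrt (κ⁻¹.toNNReal * (D * κ'.toNNReal)) + 1)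
    (fun F => le_mul_of_lt_top_imp fun hF => ?_) fun F => le_mul_of_lt_top_imp fun hF => ?_
  · obtain ⟨u, rfl⟩ := h.exists_of_dotNorm_lt_top hs h1σ hF
    refine le_of_sq_le ?_
    rw [htilde, ENNReal.coe_mul, mul_assoc]
    change _ ≤ _ * (ENNReal.ofReal κ * _)
    rw [← hint, ← lintegral_const_mul' _ _ ENNReal.coe_ne_top]
    refine setLIntegral_mono' measurableSet_Ioi fun t ht => ?_
    rw [mul_left_comm]
    gcongr
    exact hC t ht u
  · obtain ⟨u, rfl⟩ := exists_of_tildeNorm_lt_top h1σ hF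
    refine le_of_sq_le ?_
    have hdot : dotNorm μ ψ (1 + σ) (H10.toHm1 Ω u) ^ 2 =
        ENNReal.ofReal κ⁻¹ * ∫⁻ t in Ioi (0 : ℝ), ENNReal.ofReal (t ^ (-(2 * σ) - 1)) *
          spectralK μ ψ (-1) α t (A u) := by
      rw [hint, ← mul_assoc, ← ENNReal.ofReal_mul (by positivity), inv_mul_cancel₀ hκ.ne',
        ENNReal.ofReal_one, one_mul, h.dotNorm_apply hs]
      congr 2
      ring
    rw [hdot, htilde, ENNReal.coe_mul, mul_assoc]
    change ENNReal.ofReal κ⁻¹ * _ ≤ ENNReal.ofReal κ⁻¹ * _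
    gcongr
    rw [ENNReal.coe_mul, mul_assoc]
    change _ ≤ _ * (ENNReal.ofReal κ' * _)
    rw [hκ', ← lintegral_kTail _ _ hσα, ← lintegral_const_mul' _ _ ENNReal.coe_ne_top]
    refine setLIntegral_mono' measurableSet_Ioi fun t ht => ?_
    rw [mul_left_comm (D : ℝ≥0∞)]
    gcongr
    exact hDD t ht u

end

end FracElliptic

theorem proposition4p1 {d : ℕ} (hd : 1 ≤ d) (Ω : Set (FracElliptic.E d)) (hΩ : Ω.Nonempty)
    (hopen : IsOpen Ω) (hbdd : Bornology.IsBounded Ω) (hLip : FracElliptic.HasLipschitzBoundary Ω)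
    (A : FracElliptic.Sobolev Ω 1 →L[ℝ] FracElliptic.H10 Ω →L[ℝ] ℝ)
    (hsymm : ∀ u v : FracElliptic.H10 Ω, A u v = A v u)
    (hcoer : IsCoercive (FracElliptic.restrictForm A))
    (ha : FracElliptic.ConditionA Ω) (hb : FracElliptic.ConditionB A) :
    (∃ (μ : ℕ → ℝ) (ψ : ℕ → FracElliptic.H10 Ω), FracElliptic.IsEigenbasis A hcoer μ ψ) ∧
    ∀ (μ : ℕ → ℝ) (ψ : ℕ → FracElliptic.H10 Ω), FracElliptic.IsEigenbasis A hcoer μ ψ →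
      (∀ s ∈ Set.Icc (-1 : ℝ) 1, FracElliptic.CoincideWithEquivalentNorms μ ψ s) ∧
      ∀ α : ℝ, 0 < α → α ≤ 1 →
        FracElliptic.ConditionC A hcoer α → FracElliptic.ConditionD A α →
        ∀ s ∈ Set.Icc (1 : ℝ) (1 + α), FracElliptic.CoincideWithEquivalentNorms μ ψ s := by

  refine ⟨FracElliptic.exists_isEigenbasis hcoer hd hΩ hopen hbdd hsymm ha, fun μ ψ h =>
    ⟨fun s hs => (h.normEquiv_tildeNorm hopen hsymm ha.2 hs.1 hs.2).coincide,
      fun α hα hα1 hc hD s hs => FracElliptic.NormEquiv.coincide ?_⟩⟩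
  obtain ⟨σ, rfl⟩ : ∃ σ, s = 1 + σ := ⟨s - 1, by ring⟩
  have hσ : 0 ≤ σ := by linarith [hs.1]
  have hσα : σ ≤ α := by linarith [hs.2]
  rcases hσ.eq_or_lt with rfl | hσ
  · rw [add_zero]
    exact h.normEquiv_tildeNorm hopen hsymm ha.2 (by norm_num) le_rfl
  rcases hσα.eq_or_lt with rfl | hσα
  · exact h.normEquiv_tildeNorm_one_add hopen hsymm ha.2 hα hα1 hc hD
  · exact h.normEquiv_tildeNorm_one_add_of_lt hopen hsymm ha.2 hσ hσα hα1 hc hD
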